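/- Let $F$ be any field, let $n$ be a positive integer and let $\lambda$ be a partition of $n$ with parts of exactly $m$ different nonzero lengths. Let $\Sigma_k$ be the symmetric group on $\{1,\dots,k\}$, let $E_k\in F\Sigma_k$ be the sum of all transpositions in $\Sigma_k$, and let $S^\lambda$ be the Specht module over $F$ corresponding to $\lambda$, i.e. the $F\Sigma_n$-submodule of the permutation module on $\lambda$-tabloids spanned by the polytabloids $e_t=\sum_{\pi\in C_t}\operatorname{sgn}(\pi)\{t\pi\}$, where $t$ runs over the $\lambda$-tableaux and $C_t$ is the column stabilizer of $t$. For a partition $\mu$ let $E(\mu)=\sum_{(r,c)\in[\mu]}(c-r)1_F$ be the sum of the residues of all nodes (row $r$, column $c$) of its Young diagram $[\mu]$. The diagram $[\lambda]$ has exactly $m$ removable nodes and $m+1$ addable nodes; let $\lambda{\downarrow_1},\dots,\lambda{\downarrow_m}$ be the partitions of $n-1$ obtained from $\lambda$ by removing one removable node, and $\lambda{\uparrow^1},\dots,\lambda{\uparrow^{m+1}}$ the partitions of $n+1$ obtained from $\lambda$ by adding one addable node. Then the minimal polynomial over $F$ of $E_{n-1}$ acting on the restriction $S^\lambda{\downarrow_{\Sigma_{n-1}}}$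 is $$\prod_{u=1}^m\bigl(x-E(\lambda{\downarrow_u})\bigr),$$ and the minimal polynomial over $F$ of $E_{n+1}$ acting on the induced module $S^\lambda{\uparrow^{\Sigma_{n+1}}}$ is $$\prod_{u=1}^{m+1}\bigl(x-E(\lambda{\uparrow^u})\bigr).$$ -/

import Mathlib

open Equiv Polynomial

namespace YoungDiagram

open Classical in
/-- The removable nodes of `[μ]`: the nodes of `[μ]` whose removal leaves a Young diagram. -/
noncomputable def removableNodes (μ : YoungDiagram) : Finset (ℕ × ℕ) :=
  {c ∈ μ.cells | IsLowerSet (μ.cells.erase c : Set (ℕ × ℕ))}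

theorem mem_removableNodes {μ : YoungDiagram} {c : ℕ × ℕ} :
    c ∈ μ.removableNodes ↔ c ∈ μ.cells ∧ IsLowerSet (μ.cells.erase c : Set (ℕ × ℕ)) := by
  simp [removableNodes]

open Classical in
/-- The addable nodes of `[μ]`: the nodes outside `[μ]` whose addition to `[μ]` gives a Young
diagram. (The bounding box only serves to make this a finset, see `mem_addableNodes`.) -/
noncomputable def addableNodes (μ : YoungDiagram) : Finset (ℕ × ℕ) :=
  {c ∈ Finset.range (μ.card + 1) ×ˢ Finset.range (μ.card + 1) |
    c ∉ μ.cells ∧ IsLowerSet (insert c μ.cells : Set (ℕ × ℕ))}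

theorem mem_addableNodes {μ : YoungDiagram} {c : ℕ × ℕ} :
    c ∈ μ.addableNodes ↔ c ∉ μ.cells ∧ IsLowerSet (insert c μ.cells : Set (ℕ × ℕ)) := by
  simp only [addableNodes, Finset.mem_filter, and_iff_right_iff_imp, Finset.mem_product,
    Finset.mem_range, Nat.lt_succ_iff]
  rintro ⟨-, h⟩
  have key : ∀ d : ℕ × ℕ, d < c → d ∈ μ.cells := fun d hd =>
    (h hd.le (Set.mem_insert c _)).resolve_left hd.ne
  constructor
  · have h2 : (Finset.range c.1).image (fun i => (i, c.2)) ⊆ μ.cells := by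
      intro d hd
      obtain ⟨i, hi, rfl⟩ := Finset.mem_image.1 hd
      exact key _ (Prod.lt_iff.2 (Or.inl ⟨Finset.mem_range.1 hi, le_rfl⟩))
    have h3 := Finset.card_le_card h2
    rwa [Finset.card_image_of_injective _ (fun a b hab => (Prod.mk.inj hab).1),
      Finset.card_range] at h3
  · have h2 : (Finset.range c.2).image (fun j => (c.1, j)) ⊆ μ.cells := by
      intro d hd
      obtain ⟨i, hi, rfl⟩ := Finset.mem_image.1 hd
      exact key _ (Prod.lt_iff.2 (Or.inr ⟨le_rfl, Finset.mem_range.1 hi⟩))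
    have h3 := Finset.card_le_card h2
    rwa [Finset.card_image_of_injective _ (fun a b hab => (Prod.mk.inj hab).2),
      Finset.card_range] at h3

/-- The diagram obtained from `[μ]` by removing a removable node. -/
def removeNode (μ : YoungDiagram) (c : ℕ × ℕ) (hc : c ∈ μ.removableNodes) : YoungDiagram where
  cells := μ.cells.erase c
  isLowerSet := (mem_removableNodes.1 hc).2

/-- The diagram obtained from `[μ]` by adding an addable node. -/
def addNode (μ : YoungDiagram) (c : ℕ × ℕ) (hc : c ∈ μ.addableNodes) : YoungDiagram where
  cells := insert c μ.cells
  isLowerSet := by simpa using (mem_addableNodes.1 hc).2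

/-- The sum `E(μ)` in `F` of the residues of all nodes of `[μ]`, where the node in row `r` and
column `c` has residue `(c - r) 1_F` (rows and columns are numbered from `0` here, which does not
affect the difference). -/
def residueSum (F : Type*) [Field F] (μ : YoungDiagram) : F :=
  ∑ c ∈ μ.cells, ((((c.2 : ℤ) - (c.1 : ℤ)) : ℤ) : F)

/-- A `μ`-tableau: a bijection from the set of nodes of `[μ]` to the `n`-element set `Fin n`. -/
abbrev Tableau (μ : YoungDiagram) (n : ℕ) : Type := μ.cells ≃ Fin n

/-- A `μ`-tabloid: an ordered partition of the `n`-element set `Fin n` whose `i`-th part has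
cardinality `μ_i`. It is given by the function that sends each element to the index of the part
containing it. -/
abbrev Tabloid (μ : YoungDiagram) (n : ℕ) : Type :=
  {f : Fin n → ℕ // ∀ i, (Finset.univ.filter fun x => f x = i).card = μ.rowLen i}

variable {μ : YoungDiagram} {n : ℕ}

/-- Permutations move the entries of tabloids: `σ x` lies in the part of `σ • T` with the index of
the part of `T` that contains `x`. -/
instance Tabloid.instMulAction (μ : YoungDiagram) (n : ℕ) :
    MulAction (Perm (Fin n)) (Tabloid μ n) where
  smul σ T := ⟨fun x => T.1 (σ⁻¹ x), fun i => by
    rw [← T.2 i]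
    exact Finset.card_bijective (σ⁻¹ : Perm (Fin n)) (σ⁻¹).bijective (by simp)⟩
  one_smul _ := rfl
  mul_smul _ _ _ := rfl

theorem Tabloid.smul_apply (σ : Perm (Fin n)) (T : Tabloid μ n) (x : Fin n) :
    (σ • T).1 x = T.1 (σ⁻¹ x) := rfl

/-- The tabloid `{t}` of a tableau `t`: its parts are the sets of entries in the rows of `t`. -/
def Tableau.tabloid (t : Tableau μ n) : Tabloid μ n :=
  ⟨fun x => (t.symm x).1.1, fun i => by
    rw [rowLen_eq_card]
    refine Finset.card_bij (fun x _ => (t.symm x).1) ?_ ?_ ?_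
    · intro x hx
      rw [mem_row_iff]
      exact ⟨(mem_cells _).1 (t.symm x).2, (Finset.mem_filter.1 hx).2⟩
    · intro x _ y _ h
      exact t.symm.injective (Subtype.ext h)
    · intro c hc
      rw [mem_row_iff] at hc
      exact ⟨t ⟨c, (mem_cells _).2 hc.1⟩, by simpa using hc.2, by simp⟩⟩

/-- The column stabilizer `C_t` of a tableau `t`, as the set of permutations of the entries that
preserve the column of each entry. -/
def Tableau.colStabilizer (t : Tableau μ n) : Finset (Perm (Fin n)) :=
  {π | ∀ x, (t.symm (π x)).1.2 = (t.symm x).1.2}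

/-- The permutation module `M^μ`. The space of all formal `F`-linear combinations of `μ`-tabloids is
written as `MonoidAlgebra F (Tabloid μ n)`, as in `Representation.ofMulAction`; no multiplication
of tabloids is involved. -/
noncomputable abbrev permRep (F : Type*) [Field F] (μ : YoungDiagram) (n : ℕ) :
    Representation F (Perm (Fin n)) (MonoidAlgebra F (Tabloid μ n)) :=
  Representation.ofMulAction F (Perm (Fin n)) (Tabloid μ n)

/-- The polytabloid `e_t`, the sum of `sgn π {t π}` over `π` in the column stabilizer of `t`. -/
noncomputable def Tableau.polytabloid (F : Type*) [Field F] (t : Tableau μ n) :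
    MonoidAlgebra F (Tabloid μ n) :=
  ∑ π ∈ t.colStabilizer, MonoidAlgebra.single (π • t.tabloid) (((Perm.sign π : ℤ)) : F)

theorem permRep_polytabloid (F : Type*) [Field F] (σ : Perm (Fin n)) (t : Tableau μ n) :
    permRep F μ n σ (t.polytabloid F) = Tableau.polytabloid F (t.trans σ : Tableau μ n) := by
  have htab : Tableau.tabloid (t.trans σ : Tableau μ n) = σ • t.tabloid := rfl
  simp only [Tableau.polytabloid, map_sum, Representation.ofMulAction_single, htab]
  refine Finset.sum_bij (fun π _ => σ * π * σ⁻¹) ?_ ?_ ?_ ?_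
  · intro π hπ
    simp only [Tableau.colStabilizer, Finset.mem_filter, Finset.mem_univ, true_and] at hπ ⊢
    intro x
    simpa using hπ (σ⁻¹ x)
  · intro a _ b _ h
    simpa using h
  · intro π hπ
    refine ⟨σ⁻¹ * π * σ, ?_, by group⟩
    simp only [Tableau.colStabilizer, Finset.mem_filter, Finset.mem_univ, true_and] at hπ ⊢
    intro x
    simpa using hπ (σ x)
  · intro π _
    simp only [smul_smul, inv_mul_cancel_right, Perm.sign_mul, Perm.sign_inv]
    rw [mul_right_comm, Int.units_mul_self, one_mul]

/-- The Specht module `S^μ` over `F`, the submodule of `M^μ` spanned by the polytabloids. -/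
noncomputable def spechtSubmodule (F : Type*) [Field F] (μ : YoungDiagram) (n : ℕ) :
    Subrepresentation (permRep F μ n) where
  toSubmodule := Submodule.span F (Set.range fun t : Tableau μ n => t.polytabloid F)
  apply_mem_toSubmodule σ v hv := by
    refine Submodule.span_induction (p := fun v _ => permRep F μ n σ v ∈ _) ?_ ?_ ?_ ?_ hv
    · rintro _ ⟨t, rfl⟩
      exact permRep_polytabloid F σ t ▸ Submodule.subset_span ⟨(t.trans σ : Tableau μ n), rfl⟩
    · simp
    · intro x y _ _ hx hy
      simpa only [map_add] using Submodule.add_mem _ hx hy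
    · intro a x _ hx
      simpa only [map_smul] using Submodule.smul_mem _ a hx

/-- The representation of `Σ_n` on the Specht module `S^μ`. -/
noncomputable abbrev specht (F : Type*) [Field F] (μ : YoungDiagram) (n : ℕ) :
    Representation F (Perm (Fin n)) (spechtSubmodule F μ n).toSubmodule :=
  (spechtSubmodule F μ n).toRepresentation

end YoungDiagram

/-- The standard embedding of `Σ_n` into `Σ_{n+1}` as the stabilizer of the last letter. -/
noncomputable def permEmb (n : ℕ) : Perm (Fin n) →* Perm (Fin (n + 1)) :=
  Perm.viaEmbeddingHom Fin.castSuccEmb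

/-- The sum `E_n` of all transpositions in `Σ_n`, in the group algebra. -/
noncomputable def transpositionSum (F : Type*) [Field F] (n : ℕ) :
    MonoidAlgebra F (Perm (Fin n)) :=
  ∑ i : Fin n, ∑ j ∈ Finset.Ioi i, MonoidAlgebra.of F (Perm (Fin n)) (swap i j)

/-- The restriction of the Specht module `S^μ` from `Σ_{n+1}` to `Σ_n`. -/
noncomputable abbrev restrictedSpecht (F : Type*) [Field F] (μ : YoungDiagram) (n : ℕ) :
    Representation F (Perm (Fin n)) (μ.spechtSubmodule F (n + 1)).toSubmodule :=
  (μ.specht F (n + 1)).comp (permEmb n)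

/-- The induction of the Specht module `S^μ` from `Σ_n` to `Σ_{n+1}`. -/
noncomputable abbrev inducedSpecht (F : Type*) [Field F] (μ : YoungDiagram) (n : ℕ) :
    Representation F (Perm (Fin (n + 1))) (Representation.IndV (permEmb n) (μ.specht F n)) :=
  Representation.ind (permEmb n) (μ.specht F n)

/-! Let `L` be the sum of the transpositions moving the last letter, so that the transposition sum
of the larger group is that of the smaller one plus `L`. Antisymmetry within columns and a one-entry
Garnir relation show that the full transposition sum acts on a Specht module as the scalar
`residueSum`. Both claims thus reduce to understanding `L`, on the Specht module itself or on the
generating copy of it inside the induced module.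

Annihilation. For the restriction, group the polytabloids by the length of the column holding the
last letter: `L` acts on each group by the residue of a removable node, modulo polytabloids with the
last letter in a shorter column (`lastTranspositions_sub_mem`). For the induced module, fix `t` and
group the vectors obtained by extending a column of `t` antisymmetrically by the last letter: the
transposition sum acts on each group by the scalar for an addable node, modulo extensions of longer
columns (`transpositionSum_sub_mem`). Triangularity gives the product of linear factors
(`aeval_prod_apply_eq_zero`).

Minimality. Residues may coincide in `F`, so distinct eigenvalues are not available; instead the
degree is bounded below. With `v` a polytabloid, one coordinate vanishes on `L ^ j v` for `j < k`
and equals 1 on `L ^ k v`, whence no nonzero polynomial of degree at most `k` kills `v`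
(`aeval_apply_ne_zero`). The coordinate is the row assignment that shifts the letters at the
removable nodes cyclically through the last letter: it spoils `k` columns, a transposition with the
last letter repairs at most one of them, and only one sequence of `k` transpositions repairs them
all (`pow_lastTranspositions_signedSum`). Here `k + 1` is the number of removable nodes for
restriction and of addable nodes for induction. -/

namespace YoungDiagram

/-! ### Removable nodes, addable nodes and residue sums. -/

section Nodes

variable {μ : YoungDiagram}

theorem mem_removableNodes_iff {c : ℕ × ℕ} :
    c ∈ μ.removableNodes ↔ μ.rowLen c.1 = c.2 + 1 ∧ μ.colLen c.2 = c.1 + 1 := by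
  obtain ⟨r, s⟩ := c
  rw [mem_removableNodes]
  constructor
  · rintro ⟨h, hl⟩
    rw [mem_cells] at h
    have h1 := mem_iff_lt_rowLen.1 h
    have h2 := mem_iff_lt_colLen.1 h
    constructor
    · by_contra hne
      have h3 : (r, s + 1) ∈ (μ.cells.erase (r, s) : Set (ℕ × ℕ)) := by
        simp [mem_iff_lt_rowLen]; simp at h1 hne; omega
      have := @hl _ (r, s) (Prod.mk_le_mk.2 ⟨le_rfl, Nat.le_succ s⟩) h3
      simp at this
    · by_contra hne
      have h3 : (r + 1, s) ∈ (μ.cells.erase (r, s) : Set (ℕ × ℕ)) := by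
        simp [mem_iff_lt_colLen]; simp at h2 hne; omega
      have := @hl _ (r, s) (Prod.mk_le_mk.2 ⟨Nat.le_succ r, le_rfl⟩) h3
      simp at this
  · rintro ⟨h1, h2⟩
    dsimp only at h1 h2
    refine ⟨?_, ?_⟩
    · rw [mem_cells, mem_iff_lt_rowLen]; omega
    · rintro ⟨a, b⟩ ⟨a', b'⟩ hle hab
      obtain ⟨ha, hb⟩ := Prod.mk_le_mk.1 hle
      simp only [Finset.coe_erase, Set.mem_sdiff, Finset.mem_coe, mem_cells,
        Set.mem_singleton_iff] at hab ⊢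
      refine ⟨μ.up_left_mem ha hb hab.1, ?_⟩
      rintro h
      obtain ⟨rfl, rfl⟩ := Prod.mk.inj h
      apply hab.2
      have h3 := mem_iff_lt_rowLen.1 (μ.up_left_mem ha le_rfl hab.1)
      have h4 := mem_iff_lt_colLen.1 (μ.up_left_mem le_rfl hb hab.1)
      ext <;> simp <;> omega

theorem mem_addableNodes_iff {c : ℕ × ℕ} :
    c ∈ μ.addableNodes ↔ μ.rowLen c.1 = c.2 ∧ μ.colLen c.2 = c.1 := by
  obtain ⟨r, s⟩ := c
  rw [mem_addableNodes]
  constructor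
  · rintro ⟨h, hl⟩
    rw [mem_cells] at h
    have h1 := mem_iff_lt_rowLen.not.1 h
    have h2 := mem_iff_lt_colLen.not.1 h
    constructor
    · dsimp only
      by_contra hne
      have h3 := @hl _ (r, s - 1) (Prod.mk_le_mk.2 ⟨le_rfl, Nat.sub_le s 1⟩)
        (Set.mem_insert _ _)
      rcases h3 with h3 | h3
      · simp at h3; omega
      · rw [Finset.mem_coe, mem_cells, mem_iff_lt_rowLen] at h3; omega
    · dsimp only
      by_contra hne
      have h3 := @hl _ (r - 1, s) (Prod.mk_le_mk.2 ⟨Nat.sub_le r 1, le_rfl⟩)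
        (Set.mem_insert _ _)
      rcases h3 with h3 | h3
      · simp at h3; omega
      · rw [Finset.mem_coe, mem_cells, mem_iff_lt_colLen] at h3; omega
  · rintro ⟨h1, h2⟩
    dsimp only at h1 h2
    refine ⟨?_, ?_⟩
    · rw [mem_cells, mem_iff_lt_rowLen]; omega
    · rintro ⟨a, b⟩ ⟨a', b'⟩ hle hab
      obtain ⟨ha, hb⟩ := Prod.mk_le_mk.1 hle
      simp only [Set.mem_insert_iff, Finset.mem_coe, mem_cells] at hab ⊢
      rcases hab with hab | hab
      · obtain ⟨rfl, rfl⟩ := Prod.mk.inj hab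
        rcases ha.lt_or_eq with ha | rfl
        · right
          refine μ.up_left_mem le_rfl hb (mem_iff_lt_colLen.2 (by omega))
        · rcases hb.lt_or_eq with hb | rfl
          · exact Or.inr (mem_iff_lt_rowLen.2 (by omega))
          · exact Or.inl rfl
      · exact Or.inr (μ.up_left_mem ha hb hab)

theorem mem_toFinset_rowLens {k : ℕ} :
    k ∈ μ.rowLens.toFinset ↔ 0 < k ∧ ∃ i, μ.rowLen i = k := by
  simp only [List.mem_toFinset, rowLens, List.mem_map, List.mem_range]
  constructor
  · rintro ⟨i, hi, rfl⟩
    exact ⟨mem_iff_lt_rowLen.1 (mem_iff_lt_colLen.2 hi), i, rfl⟩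
  · rintro ⟨hk, i, rfl⟩
    exact ⟨i, mem_iff_lt_colLen.1 (mem_iff_lt_rowLen.2 hk), rfl⟩

/-- The node at the end of the last row that meets the last column of the height of column `j`. -/
theorem removable_of_mem {i j : ℕ} (h : (i, j) ∈ μ) :
    (μ.colLen j - 1, μ.rowLen (μ.colLen j - 1) - 1) ∈ μ.removableNodes := by
  rw [mem_removableNodes_iff]
  dsimp only
  have h1 := mem_iff_lt_colLen.1 h
  have h2 : (μ.colLen j - 1, j) ∈ μ := mem_iff_lt_colLen.2 (by omega)
  have h3 := mem_iff_lt_rowLen.1 h2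
  have h4 : (μ.colLen j - 1, μ.rowLen (μ.colLen j - 1) - 1) ∈ μ := mem_iff_lt_rowLen.2 (by omega)
  have h5 := mem_iff_lt_colLen.1 h4
  have h6 := μ.colLen_anti j (μ.rowLen (μ.colLen j - 1) - 1) (by omega)
  omega

/-- This node indexes the columns of the same height as column `j`; a column beyond the diagram, of
height 0, gives the addable node of the top row. -/
theorem addable_colLen (j : ℕ) : (μ.colLen j, μ.rowLen (μ.colLen j)) ∈ μ.addableNodes := by
  rw [mem_addableNodes_iff]
  dsimp only
  refine ⟨rfl, ?_⟩
  have h1 : ¬ (μ.colLen j, j) ∈ μ := mem_iff_lt_colLen.not.2 (lt_irrefl _)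
  have h2 := mem_iff_lt_rowLen.not.1 h1
  have h3 := μ.colLen_anti _ _ (not_lt.1 h2)
  have h4 : ¬ (μ.colLen j, μ.rowLen (μ.colLen j)) ∈ μ := mem_iff_lt_rowLen.not.2 (lt_irrefl _)
  have h5 := mem_iff_lt_colLen.not.1 h4
  omega

/-- The last row of each nonzero length carries exactly one removable node, so the row length is a
bijection. -/
theorem card_removableNodes : μ.removableNodes.card = μ.rowLens.toFinset.card := by
  refine Finset.card_bij (fun c _ => μ.rowLen c.1) ?_ ?_ ?_
  · intro c hc
    rw [mem_removableNodes_iff] at hc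
    exact mem_toFinset_rowLens.2 ⟨by omega, _, rfl⟩
  · intro c hc d hd h
    rw [mem_removableNodes_iff] at hc hd
    have h2 : c.2 = d.2 := by omega
    rw [h2] at hc
    exact Prod.ext (by omega) h2
  · intro k hk
    obtain ⟨hk, i, rfl⟩ := mem_toFinset_rowLens.1 hk
    have h : (i, μ.rowLen i - 1) ∈ μ := mem_iff_lt_rowLen.2 (by omega)
    refine ⟨_, removable_of_mem h, ?_⟩
    have h1 := mem_iff_lt_colLen.1 h
    have h2 : (μ.colLen (μ.rowLen i - 1) - 1, μ.rowLen i - 1) ∈ μ :=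
      mem_iff_lt_colLen.2 (by omega)
    have h3 := mem_iff_lt_rowLen.1 h2
    have h4 := μ.rowLen_anti i (μ.colLen (μ.rowLen i - 1) - 1) (by omega)
    dsimp only
    omega

/-- Same bijection, now from the first row of each length; the extra value 0 comes from the first
empty row. -/
theorem card_addableNodes : μ.addableNodes.card = μ.rowLens.toFinset.card + 1 := by
  have h0 : 0 ∉ μ.rowLens.toFinset := fun h => (mem_toFinset_rowLens.1 h).1.ne rfl
  rw [← Finset.card_insert_of_notMem h0]
  refine Finset.card_bij (fun c _ => μ.rowLen c.1) ?_ ?_ ?_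
  · intro c hc
    rw [Finset.mem_insert, mem_toFinset_rowLens]
    rcases Nat.eq_zero_or_pos (μ.rowLen c.1) with h | h
    · exact Or.inl h
    · exact Or.inr ⟨h, _, rfl⟩
  · intro c hc d hd h
    rw [mem_addableNodes_iff] at hc hd
    have h2 : c.2 = d.2 := by omega
    rw [h2] at hc
    exact Prod.ext (by omega) h2
  · intro k hk
    refine ⟨_, addable_colLen k, ?_⟩
    have h4 : ¬ (μ.colLen k, k) ∈ μ := mem_iff_lt_colLen.not.2 (lt_irrefl _)
    have h5 := mem_iff_lt_rowLen.not.1 h4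
    dsimp only
    rw [Finset.mem_insert, mem_toFinset_rowLens] at hk
    rcases hk with rfl | ⟨hk, i, rfl⟩
    · omega
    · have h1 : ¬ (i, μ.rowLen i) ∈ μ := mem_iff_lt_rowLen.not.2 (lt_irrefl _)
      have h2 := mem_iff_lt_colLen.not.1 h1
      have := μ.rowLen_anti _ _ (not_lt.1 h2)
      omega

theorem residueSum_removeNode (F : Type*) [Field F] {c : ℕ × ℕ} (hc : c ∈ μ.removableNodes) :
    (μ.removeNode c hc).residueSum F = μ.residueSum F - ((c.2 : F) - c.1) := by
  have h := Finset.sum_erase_add μ.cells (fun c : ℕ × ℕ => ((((c.2 : ℤ) - (c.1 : ℤ)) : ℤ) : F))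
    (mem_removableNodes.1 hc).1
  rw [residueSum, residueSum, ← h]
  simp [removeNode]

theorem residueSum_addNode (F : Type*) [Field F] {c : ℕ × ℕ} (hc : c ∈ μ.addableNodes) :
    (μ.addNode c hc).residueSum F = μ.residueSum F + ((c.2 : F) - c.1) := by
  rw [residueSum, residueSum]
  have : (μ.addNode c hc).cells = insert c μ.cells := rfl
  rw [this, Finset.sum_insert (mem_addableNodes.1 hc).1, add_comm]
  simp

end Nodes

end YoungDiagram

/-! ### Column antisymmetry and the Garnir relation for polytabloids. -/

namespace YoungDiagram

variable {μ : YoungDiagram} {n : ℕ}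

theorem Tabloid.swap_smul_eq {T : Tabloid μ n} {a b : Fin n} (h : T.1 a = T.1 b) :
    swap a b • T = T := by
  refine Subtype.ext (funext fun x => ?_)
  rw [Tabloid.smul_apply, swap_inv]
  rcases eq_or_ne x a with rfl | ha
  · rw [swap_apply_left, h]
  · rcases eq_or_ne x b with rfl | hb
    · rw [swap_apply_right, h]
    · rw [swap_apply_of_ne_of_ne ha hb]

namespace Tableau

/-- The row of the entry `x` in the tableau `t`. -/
def row (t : Tableau μ n) (x : Fin n) : ℕ := (t.symm x).1.1

/-- The column of the entry `x` in the tableau `t`. -/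
def col (t : Tableau μ n) (x : Fin n) : ℕ := (t.symm x).1.2

variable (t : Tableau μ n)

theorem row_lt (x : Fin n) : t.row x < μ.colLen (t.col x) :=
  mem_iff_lt_colLen.1 ((mem_cells _).1 (t.symm x).2)

theorem col_lt (x : Fin n) : t.col x < μ.rowLen (t.row x) :=
  mem_iff_lt_rowLen.1 ((mem_cells _).1 (t.symm x).2)

theorem eq_of_row_of_col {x y : Fin n} (hr : t.row x = t.row y) (hc : t.col x = t.col y) :
    x = y :=
  t.symm.injective (Subtype.ext (Prod.ext hr hc))

theorem exists_entry {i j : ℕ} (h : (i, j) ∈ μ) : ∃ x, t.row x = i ∧ t.col x = j :=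
  ⟨t ⟨(i, j), (mem_cells _).2 h⟩, by simp [row], by simp [col]⟩

theorem mem_colStabilizer {π : Perm (Fin n)} :
    π ∈ t.colStabilizer ↔ ∀ x, t.col (π x) = t.col x := by
  simp [colStabilizer, col]

theorem smul_tabloid_apply (π : Perm (Fin n)) (x : Fin n) :
    (π • t.tabloid).1 x = t.row (π⁻¹ x) := rfl

theorem mul_mem_colStabilizer {π σ : Perm (Fin n)} (hπ : π ∈ t.colStabilizer)
    (hσ : σ ∈ t.colStabilizer) : π * σ ∈ t.colStabilizer := by
  rw [mem_colStabilizer] at *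
  intro x
  rw [Perm.mul_apply, hπ, hσ]

theorem inv_mem_colStabilizer {π : Perm (Fin n)} (hπ : π ∈ t.colStabilizer) :
    π⁻¹ ∈ t.colStabilizer := by
  rw [mem_colStabilizer] at *
  intro x
  rw [← hπ, Perm.coe_inv, apply_symm_apply]

theorem swap_mem_colStabilizer {x y : Fin n} (h : t.col x = t.col y) :
    swap x y ∈ t.colStabilizer := by
  rw [mem_colStabilizer]
  intro w
  rcases eq_or_ne w x with rfl | ha
  · rw [swap_apply_left, h]
  · rcases eq_or_ne w y with rfl | hb
    · rw [swap_apply_right, h]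
    · rw [swap_apply_of_ne_of_ne ha hb]

variable (F : Type*) [Field F]

theorem permRep_polytabloid_eq_sum (σ : Perm (Fin n)) :
    permRep F μ n σ (t.polytabloid F) =
      ∑ π ∈ t.colStabilizer, MonoidAlgebra.single ((σ * π) • t.tabloid) (((Perm.sign π : ℤ)) : F) := by
  simp only [polytabloid, map_sum, Representation.ofMulAction_single, mul_smul]

theorem swap_polytabloid_of_col_eq {x y : Fin n} (hxy : x ≠ y) (h : t.col x = t.col y) :
    permRep F μ n (swap x y) (t.polytabloid F) = -t.polytabloid F := by
  rw [permRep_polytabloid_eq_sum, polytabloid, ← Finset.sum_neg_distrib]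
  refine Finset.sum_bij (fun π _ => swap x y * π) ?_ ?_ ?_ ?_
  · intro π hπ
    exact t.mul_mem_colStabilizer (t.swap_mem_colStabilizer h) hπ
  · intro a _ b _ hab
    exact mul_left_cancel hab
  · intro π hπ
    exact ⟨swap x y * π, t.mul_mem_colStabilizer (t.swap_mem_colStabilizer h) hπ, by
      rw [swap_mul_self_mul]⟩
  · intro π _
    rw [Perm.sign_mul, Perm.sign_swap hxy, ← MonoidAlgebra.single_neg]
    simp

/-- The Garnir relation for a single entry `y` and a column at least as long as that of `y`. -/
theorem sum_swap_polytabloid {y : Fin n} {j : ℕ} (hj : t.col y ≠ j)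
    (h : μ.colLen (t.col y) ≤ μ.colLen j) :
    ∑ x with t.col x = j, permRep F μ n (swap x y) (t.polytabloid F) = t.polytabloid F := by
  -- `w π` is the entry of column `j` lying in the same row as `y` in the permuted tableau; it
  -- exists because column `j` is long enough. The transposition of `w π` and `y` fixes the tabloid,
  -- so these terms alone add up to the polytabloid.
  have hex : ∀ π : Perm (Fin n), ∃ w, π ∈ t.colStabilizer →
      t.col w = j ∧ t.row (π⁻¹ w) = t.row (π⁻¹ y) := by
    intro π
    by_cases hπ : π ∈ t.colStabilizer
    · have h1 := t.row_lt (π⁻¹ y)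
      rw [(t.mem_colStabilizer).1 (t.inv_mem_colStabilizer hπ)] at h1
      obtain ⟨x, hx, hxj⟩ := t.exists_entry (mem_iff_lt_colLen.2 (h1.trans_le h))
      refine ⟨π x, fun _ => ⟨?_, ?_⟩⟩
      · rw [(t.mem_colStabilizer).1 hπ, hxj]
      · rw [show π⁻¹ (π x) = x from symm_apply_apply π x, hx]
    · exact ⟨y, fun h => absurd h hπ⟩
  choose w hw using hex
  have huniq : ∀ π ∈ t.colStabilizer, ∀ x, t.col x = j → t.row (π⁻¹ x) = t.row (π⁻¹ y) →
      x = w π := by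
    intro π hπ x hx hr
    have hinv := (t.mem_colStabilizer).1 (t.inv_mem_colStabilizer hπ)
    refine π⁻¹.injective (t.eq_of_row_of_col ?_ ?_)
    · rw [hr, (hw π hπ).2]
    · rw [hinv, hinv, hx, (hw π hπ).1]
  have hwy : ∀ π ∈ t.colStabilizer, w π ≠ y := fun π hπ he => hj (he ▸ (hw π hπ).1)
  simp only [permRep_polytabloid_eq_sum]
  rw [Finset.sum_comm]
  have hsplit : ∀ π ∈ t.colStabilizer, ∑ x with t.col x = j,
      MonoidAlgebra.single ((swap x y * π) • t.tabloid) ((Perm.sign π : ℤ) : F) =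
      MonoidAlgebra.single (π • t.tabloid) ((Perm.sign π : ℤ) : F) +
      ∑ x ∈ ({x | t.col x = j} : Finset (Fin n)).erase (w π),
        MonoidAlgebra.single ((swap x y * π) • t.tabloid) ((Perm.sign π : ℤ) : F) := by
    intro π hπ
    rw [← Finset.add_sum_erase _ _ (by simpa using (hw π hπ).1 : w π ∈ _), mul_smul,
      Tabloid.swap_smul_eq]
    exact (hw π hπ).2
  rw [Finset.sum_congr rfl hsplit, Finset.sum_add_distrib, ← polytabloid, add_eq_left,
    Finset.sum_sigma']
  have key : ∀ π ∈ t.colStabilizer, ∀ x, t.col x = j → x ≠ w π →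
      swap x (w π) * π ∈ t.colStabilizer ∧ w (swap x (w π) * π) = x := by
    intro π hπ x hx hxw
    have hmem := t.mul_mem_colStabilizer
      (t.swap_mem_colStabilizer (hx.trans (hw π hπ).1.symm)) hπ
    refine ⟨hmem, (huniq _ hmem x hx ?_).symm⟩
    have hyx : y ≠ x := by rintro rfl; exact hj hx
    rw [mul_inv_rev, swap_inv, Perm.mul_apply, Perm.mul_apply, swap_apply_left,
      swap_apply_of_ne_of_ne hyx (hwy π hπ).symm, (hw π hπ).2]
  -- The remaining terms cancel in pairs: exchanging `x` and `w π` preserves the tabloid of the term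
  -- and reverses the sign.
  refine Finset.sum_involution (fun p _ => ⟨swap p.2 (w p.1) * p.1, w p.1⟩) ?_ ?_ ?_ ?_
  · rintro ⟨π, x⟩ hp
    simp only [Finset.mem_sigma, Finset.mem_erase, Finset.mem_filter, Finset.mem_univ,
      true_and] at hp ⊢
    obtain ⟨hπ, hxw, hx⟩ := hp
    have hyx : y ≠ x := by rintro rfl; exact hj hx
    have h1 : swap (w π) y * (swap x (w π) * π) = swap x (w π) * (swap x y * π) := by
      rw [← mul_assoc, ← mul_assoc]
      congr 1
      rw [← mul_left_inj (swap x (w π)), mul_assoc, swap_mul_self, mul_one, swap_comm x y,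
        swap_mul_swap_mul_swap hyx (hwy π hπ).symm]
    rw [h1, mul_smul (swap x (w π)), Tabloid.swap_smul_eq, Perm.sign_mul, Perm.sign_swap hxw,
      ← MonoidAlgebra.single_add]
    · simp
    · rw [smul_tabloid_apply, smul_tabloid_apply, mul_inv_rev, swap_inv, Perm.mul_apply,
        Perm.mul_apply, swap_apply_left, swap_apply_of_ne_of_ne hxw.symm (hwy π hπ), (hw π hπ).2]
  · rintro ⟨π, x⟩ hp _ he
    simp only [Finset.mem_sigma, Finset.mem_erase, Finset.mem_filter, Finset.mem_univ,
      true_and] at hp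
    simp only [Sigma.mk.injEq, heq_eq_eq] at he
    exact hp.2.1 he.2.symm
  · rintro ⟨π, x⟩ hp
    simp only [Finset.mem_sigma, Finset.mem_erase, Finset.mem_filter, Finset.mem_univ,
      true_and] at hp ⊢
    obtain ⟨hπ, hxw, hx⟩ := hp
    obtain ⟨h1, h2⟩ := key π hπ x hx hxw
    exact ⟨h1, by rw [h2]; exact hxw.symm, (hw π hπ).1⟩
  · rintro ⟨π, x⟩ hp
    simp only [Finset.mem_sigma, Finset.mem_erase, Finset.mem_filter, Finset.mem_univ,
      true_and] at hp
    obtain ⟨hπ, hxw, hx⟩ := hp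
    obtain ⟨h1, h2⟩ := key π hπ x hx hxw
    simp only [h2, Sigma.mk.injEq, heq_eq_eq, and_true]
    rw [swap_comm, swap_mul_self_mul]

end Tableau

end YoungDiagram

/-! ### The transposition sum and its scalar action on the Specht module. -/

/-- A sum of a symmetric function over all pairs does not depend on the order of the letters. -/
theorem sum_Ioi_eq_sum_lt {n : ℕ} {M α : Type*} [AddCommMonoid M] [LinearOrder α]
    (key : Fin n → α) (hkey : Function.Injective key) (f : Fin n → Fin n → M)
    (hf : ∀ i j, f i j = f j i) :
    ∑ i, ∑ j ∈ Finset.Ioi i, f i j = ∑ y, ∑ x with key x < key y, f x y := by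
  have h1 : ∀ i, ∑ j ∈ Finset.Ioi i, f i j =
      ∑ j, ((if i < j ∧ key i < key j then f i j else 0) +
        if i < j ∧ key j < key i then f i j else 0) := by
    intro i
    rw [← Finset.filter_lt_eq_Ioi, Finset.sum_filter]
    refine Finset.sum_congr rfl fun j _ => ?_
    by_cases hij : i < j
    · rcases lt_or_gt_of_ne (hkey.ne hij.ne) with h | h
      · simp [hij, h, h.not_gt]
      · simp [hij, h, h.not_gt]
    · simp [hij]
  have h2 : ∀ y, ∑ x with key x < key y, f x y =
      ∑ x, ((if x < y ∧ key x < key y then f x y else 0) +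
        if y < x ∧ key x < key y then f y x else 0) := by
    intro y
    rw [Finset.sum_filter]
    refine Finset.sum_congr rfl fun x _ => ?_
    by_cases hxy : key x < key y
    · have hne : x ≠ y := by rintro rfl; exact lt_irrefl _ hxy
      rcases lt_or_gt_of_ne hne with h | h
      · simp [hxy, h, h.not_gt]
      · simp [hxy, h, h.not_gt, hf x y]
    · simp [hxy]
  simp only [h1, h2, Finset.sum_add_distrib]
  rw [Finset.sum_comm]

section Transpositions

variable {F V : Type*} [Field F] [AddCommGroup V] [Module F V] {n : ℕ}

theorem asAlgebraHom_transpositionSum (ρ : Representation F (Perm (Fin n)) V) :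
    ρ.asAlgebraHom (transpositionSum F n) = ∑ i, ∑ j ∈ Finset.Ioi i, ρ (swap i j) := by
  simp only [transpositionSum, map_sum, Representation.asAlgebraHom_of]

/-- The action of the sum of the transpositions that move the last letter. -/
def lastTranspositions (ρ : Representation F (Perm (Fin (n + 1))) V) : Module.End F V :=
  ∑ i : Fin n, ρ (swap i.castSucc (Fin.last n))

theorem permEmb_apply_castSucc (σ : Perm (Fin n)) (i : Fin n) :
    permEmb n σ i.castSucc = (σ i).castSucc :=
  Perm.viaEmbedding_apply σ Fin.castSuccEmb i

theorem permEmb_apply_last (σ : Perm (Fin n)) : permEmb n σ (Fin.last n) = Fin.last n := by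
  refine Perm.viaEmbedding_apply_of_notMem σ Fin.castSuccEmb _ ?_
  rintro ⟨i, hi⟩
  exact (Fin.castSucc_lt_last i).ne hi

theorem permEmb_swap (i j : Fin n) : permEmb n (swap i j) = swap i.castSucc j.castSucc := by
  ext x
  congr 1
  refine Fin.lastCases ?_ (fun k => ?_) x
  · rw [permEmb_apply_last, swap_apply_of_ne_of_ne (Fin.castSucc_lt_last _).ne'
      (Fin.castSucc_lt_last _).ne']
  · rw [permEmb_apply_castSucc, ← (Fin.castSucc_injective n).map_swap]

theorem asAlgebraHom_transpositionSum_succ (ρ : Representation F (Perm (Fin (n + 1))) V) :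
    ρ.asAlgebraHom (transpositionSum F (n + 1)) =
      Representation.asAlgebraHom (ρ.comp (permEmb n)) (transpositionSum F n) + lastTranspositions ρ := by
  rw [asAlgebraHom_transpositionSum, asAlgebraHom_transpositionSum, lastTranspositions,
    Fin.sum_univ_castSucc]
  have h0 : Finset.Ioi (Fin.last n) = ∅ := by
    ext x
    simpa using Fin.le_last x
  rw [h0, Finset.sum_empty, add_zero, ← Finset.sum_add_distrib]
  refine Finset.sum_congr rfl fun i _ => ?_
  rw [← Finset.filter_lt_eq_Ioi, ← Finset.filter_lt_eq_Ioi, Finset.sum_filter, Finset.sum_filter,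
    Fin.sum_univ_castSucc, if_pos (Fin.castSucc_lt_last i)]
  congr 1
  refine Finset.sum_congr rfl fun j _ => ?_
  simp only [Fin.castSucc_lt_castSucc_iff, MonoidHom.comp_apply, permEmb_swap]

end Transpositions

namespace YoungDiagram

variable {μ : YoungDiagram} {n : ℕ} (F : Type*) [Field F]

namespace Tableau

variable (t : Tableau μ n)

theorem card_filter_col (j : ℕ) : ({x | t.col x = j} : Finset (Fin n)).card = μ.colLen j := by
  rw [colLen_eq_card]
  refine Finset.card_bij (fun x _ => (t.symm x).1) ?_ ?_ ?_
  · intro x hx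
    rw [mem_col_iff]
    exact ⟨(mem_cells _).1 (t.symm x).2, (Finset.mem_filter.1 hx).2⟩
  · intro x _ y _ h
    exact t.symm.injective (Subtype.ext h)
  · intro c hc
    rw [mem_col_iff] at hc
    exact ⟨t ⟨c, (mem_cells _).2 hc.1⟩, Finset.mem_filter.2 ⟨Finset.mem_univ _, by simpa [col] using hc.2⟩, by simp⟩

theorem sum_residue :
    ∑ y, ((t.col y : F) - t.row y) = μ.residueSum F := by
  rw [residueSum, ← Finset.sum_coe_sort μ.cells, ← t.sum_comp]
  refine Finset.sum_congr rfl fun c _ => ?_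
  simp [row, col]

theorem card_filter_row_lt (y : Fin n) :
    ({x | t.col x = t.col y ∧ t.row x < t.row y} : Finset (Fin n)).card = t.row y := by
  rw [← Finset.card_range (t.row y)]
  refine Finset.card_bij (fun x _ => t.row x) ?_ ?_ ?_
  · intro x hx
    simpa using (Finset.mem_filter.1 hx).2.2
  · intro a ha b hb h
    simp only [Finset.mem_filter] at ha hb
    exact t.eq_of_row_of_col h (ha.2.1.trans hb.2.1.symm)
  · intro i hi
    obtain ⟨x, hx, hxc⟩ := t.exists_entry
      (mem_iff_lt_colLen.2 ((Finset.mem_range.1 hi).trans (t.row_lt y)))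
    refine ⟨x, ?_, hx⟩
    simpa [hx, hxc] using hi

/-- The sum of all transpositions acts on polytabloids by the sum of the residues. -/
theorem sum_swap_polytabloid_eq_residueSum :
    ∑ i, ∑ j ∈ Finset.Ioi i, permRep F μ n (swap i j) (t.polytabloid F) =
      μ.residueSum F • t.polytabloid F := by
  -- Ordering the entries by column, then row, leaves for each `y` only whole columns further left,
  -- which are at least as long and contribute 1 each by the Garnir relation, and the entries above
  -- `y`, which contribute -1 each.
  rw [sum_Ioi_eq_sum_lt (fun x => toLex (t.col x, t.row x))
    (fun x y h => t.eq_of_row_of_col (Prod.mk.inj h).2 (Prod.mk.inj h).1)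
    _ fun i j => by rw [swap_comm], ← t.sum_residue F, Finset.sum_smul]
  refine Finset.sum_congr rfl fun y _ => ?_
  have hsplit : ({x | toLex (t.col x, t.row x) < toLex (t.col y, t.row y)} : Finset (Fin n)) =
      ((Finset.range (t.col y)).biUnion fun j => {x | t.col x = j}) ∪
        ({x | t.col x = t.col y ∧ t.row x < t.row y} : Finset (Fin n)) := by
    ext x
    simp [Prod.Lex.toLex_lt_toLex]
  rw [hsplit, Finset.sum_union, Finset.sum_biUnion, sub_smul, sub_eq_add_neg]
  · congr 1
    · rw [Finset.sum_congr rfl fun j hj => t.sum_swap_polytabloid F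
        (Finset.mem_range.1 hj).ne' (μ.colLen_anti _ _ (Finset.mem_range.1 hj).le)]
      simp [Nat.cast_smul_eq_nsmul]
    · rw [Finset.sum_congr rfl fun x hx => t.swap_polytabloid_of_col_eq F
        (show x ≠ y by rintro rfl; simp at hx) (Finset.mem_filter.1 hx).2.1]
      rw [Finset.sum_const, t.card_filter_row_lt, smul_neg, Nat.cast_smul_eq_nsmul]
  · intro i _ j _ hij
    rw [Function.onFun, Finset.disjoint_left]
    intro x hx hx'
    simp only [Finset.mem_filter] at hx hx'
    exact hij (hx.2.symm.trans hx'.2)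
  · rw [Finset.disjoint_left]
    intro x hx hx'
    simp only [Finset.mem_biUnion, Finset.mem_filter, Finset.mem_range] at hx hx'
    obtain ⟨j, hj, -, rfl⟩ := hx
    exact hj.ne hx'.2.1

/-- The polytabloid of `t` as a vector of the Specht module. -/
noncomputable def spechtVec : (μ.spechtSubmodule F n).toSubmodule :=
  ⟨t.polytabloid F, Submodule.subset_span ⟨t, rfl⟩⟩

end Tableau

/-- A representation spanned by vectors indexed by tableaux that satisfy the straightening relations
of the polytabloids. -/
structure IsPolytabloidFamily {F V : Type*} [Field F] [AddCommGroup V] [Module F V]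
    (ρ : Representation F (Perm (Fin n)) V) (e : Tableau μ n → V) : Prop where
  span_eq_top : Submodule.span F (Set.range e) = ⊤
  map_apply : ∀ σ t, ρ σ (e t) = e (t.trans σ)
  swap_apply_of_col_eq : ∀ (t : Tableau μ n) {x y : Fin n}, x ≠ y → t.col x = t.col y →
    ρ (swap x y) (e t) = -e t
  sum_swap_apply : ∀ (t : Tableau μ n) {y : Fin n} {j : ℕ}, t.col y ≠ j →
    μ.colLen (t.col y) ≤ μ.colLen j → ∑ x with t.col x = j, ρ (swap x y) (e t) = e t
  transpositionSum_eq : ρ.asAlgebraHom (transpositionSum F n) = algebraMap F _ (μ.residueSum F)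

theorem isPolytabloidFamily_specht :
    IsPolytabloidFamily (μ.specht F n) (Tableau.spechtVec (μ := μ) F) := by
  have hspan : Submodule.span F (Set.range fun t : Tableau μ n => t.spechtVec F) = ⊤ := by
    rw [← Submodule.map_injective_of_injective
      (Submodule.subtype_injective (μ.spechtSubmodule F n).toSubmodule) |>.eq_iff,
      Submodule.map_span, Submodule.map_top, Submodule.range_subtype, ← Set.range_comp]
    rfl
  refine ⟨hspan, fun σ t => Subtype.ext (permRep_polytabloid F σ t),
    fun t _ _ hxy h => Subtype.ext (t.swap_polytabloid_of_col_eq F hxy h),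
    fun t y j hj h => Subtype.ext ?_, ?_⟩
  · rw [AddSubmonoidClass.coe_finsetSum]
    exact t.sum_swap_polytabloid F hj h
  · refine LinearMap.ext_on_range hspan fun t => Subtype.ext ?_
    rw [asAlgebraHom_transpositionSum, Module.algebraMap_end_apply]
    simp only [LinearMap.sum_apply, AddSubmonoidClass.coe_finsetSum]
    exact t.sum_swap_polytabloid_eq_residueSum F

end YoungDiagram

/-! ### Annihilating polynomial for the restriction. -/

/-- If an operator acts triangularly on a finite family of subspaces, the product of the
corresponding linear factors annihilates all of them. -/
theorem aeval_prod_apply_eq_zero {F V ι : Type*} [Field F] [AddCommGroup V] [Module F V]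
    (D : Module.End F V) (key : ι → ℕ) (a : ι → F) (U : ι → Submodule F V) (S : Finset ι)
    (h : ∀ i ∈ S, ∀ v ∈ U i, D v - a i • v ∈ ⨆ j ∈ S, ⨆ _ : key j < key i, U j) :
    ∀ i ∈ S, ∀ v ∈ U i, aeval D (∏ i ∈ S, (X - C (a i))) v = 0 := by
  classical
  -- The index `b` of maximal key never occurs below another one, so the factors for `s` already
  -- kill the other subspaces, and the factor for `b` sends `U b` into their sum.
  induction S using Finset.induction_on_max_value key with
  | empty => simp
  | insert b s hb hmax ih =>
    have hle : ∀ i ∈ insert b s, (⨆ j ∈ insert b s, ⨆ _ : key j < key i, U j) ≤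
        ⨆ j ∈ s, ⨆ _ : key j < key i, U j := by
      intro i hi
      refine iSup₂_le fun j hj => iSup_le fun hji => ?_
      rcases Finset.mem_insert.1 hj with rfl | hj
      · rcases Finset.mem_insert.1 hi with rfl | hi
        · exact absurd hji (lt_irrefl _)
        · exact absurd hji (hmax i hi).not_gt
      · exact le_iSup₂_of_le j hj (le_iSup_of_le hji le_rfl)
    have ih' := ih fun i hi v hv =>
      hle i (Finset.mem_insert_of_mem hi) (h i (Finset.mem_insert_of_mem hi) v hv)
    intro i hi v hv
    rw [Finset.prod_insert hb]
    rcases Finset.mem_insert.1 hi with rfl | hi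
    · rw [mul_comm, map_mul, Module.End.mul_apply]
      have h1 : aeval D (X - C (a i)) v = D v - a i • v := by
        simp [Module.algebraMap_end_apply]
      rw [h1, ← LinearMap.mem_ker]
      refine (iSup₂_le fun j hj => iSup_le fun _ => ?_ :
        (⨆ j ∈ s, ⨆ _ : key j < key i, U j) ≤ _) (hle i hi (h i hi v hv))
      exact fun w hw => ih' j hj w hw
    · rw [map_mul, Module.End.mul_apply, ih' i hi v hv, map_zero]

theorem Fin.sum_castSucc_eq_sum_ne {n : ℕ} {M : Type*} [AddCommMonoid M] (f : Fin (n + 1) → M) :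
    ∑ i : Fin n, f i.castSucc = ∑ x with x ≠ Fin.last n, f x := by
  rw [Finset.sum_filter, Fin.sum_univ_castSucc]
  simp [(Fin.castSucc_lt_last _).ne]

namespace YoungDiagram

variable {μ : YoungDiagram} {n : ℕ} {F V : Type*} [Field F] [AddCommGroup V] [Module F V]

/-- The span of the polytabloids with the last letter in a column that ends in the same row as the
node `c`. -/
def lastColSpan (F : Type*) {V : Type*} [Field F] [AddCommGroup V] [Module F V]
    (e : Tableau μ (n + 1) → V) (c : ℕ × ℕ) : Submodule F V :=
  Submodule.span F {v | ∃ t, μ.colLen (t.col (Fin.last n)) = c.1 + 1 ∧ e t = v}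

theorem exists_mem_lastColSpan (e : Tableau μ (n + 1) → V) (t : Tableau μ (n + 1)) :
    ∃ c ∈ μ.removableNodes, c.1 + 1 = μ.colLen (t.col (Fin.last n)) ∧ e t ∈ lastColSpan F e c := by
  have h := t.row_lt (Fin.last n)
  have hc := removable_of_mem (mem_iff_lt_colLen.2 h)
  refine ⟨_, hc, by dsimp only; omega, Submodule.subset_span ⟨t, by dsimp only; omega, rfl⟩⟩

namespace IsPolytabloidFamily

variable {ρ : Representation F (Perm (Fin (n + 1))) V} {e : Tableau μ (n + 1) → V}

/-- The other `c.1` letters in the column of the last letter contribute -1 each. The columns at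
least as long are the first `c.2 + 1`; each except its own contributes 1 by the Garnir relation. A
swap with a letter of a shorter column moves the last letter into that column, hence into the error
term. -/
theorem lastTranspositions_sub_mem (he : IsPolytabloidFamily ρ e) {c : ℕ × ℕ}
    (hc : c ∈ μ.removableNodes) {v : V} (hv : v ∈ lastColSpan F e c) :
    lastTranspositions ρ v - ((c.2 : F) - c.1) • v ∈
      ⨆ d ∈ μ.removableNodes, ⨆ _ : d.1 < c.1, lastColSpan F e d := by
  induction hv using Submodule.span_induction with
  | zero => simp
  | add x y _ _ hx hy =>
    rw [map_add, smul_add, add_sub_add_comm]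
    exact Submodule.add_mem _ hx hy
  | smul a x _ hx =>
    rw [map_smul, smul_comm, ← smul_sub]
    exact Submodule.smul_mem _ _ hx
  | mem v hv =>
    obtain ⟨t, ht, rfl⟩ := hv
    obtain ⟨hr, hcl⟩ := mem_removableNodes_iff.1 hc
    set z := Fin.last n
    set j := t.col z with hj
    have hcol : ∀ i, i < μ.rowLen c.1 ↔ c.1 < μ.colLen i := fun i => by
      rw [← mem_iff_lt_rowLen, mem_iff_lt_colLen]
    have hsplit : ({x | x ≠ z} : Finset (Fin (n + 1))) =
        (({x | t.col x = j} : Finset (Fin (n + 1))).erase z ∪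
          ((Finset.range (μ.rowLen c.1)).erase j).biUnion fun i => {x | t.col x = i}) ∪
          ({x | μ.rowLen c.1 ≤ t.col x} : Finset (Fin (n + 1))) := by
      ext x
      simp only [Finset.mem_filter, Finset.mem_univ, true_and, Finset.mem_union, Finset.mem_erase,
        Finset.mem_biUnion, Finset.mem_range, exists_eq_right']
      constructor
      · intro hx
        by_cases h1 : t.col x = j
        · exact Or.inl (Or.inl ⟨hx, h1⟩)
        · rcases lt_or_ge (t.col x) (μ.rowLen c.1) with h2 | h2
          · exact Or.inl (Or.inr ⟨h1, h2⟩)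
          · exact Or.inr h2
      · rintro ((h | h) | h) rfl
        · exact h.1 rfl
        · exact h.1 hj.symm
        · exact h.not_gt ((hcol _).2 (by rw [← hj]; omega))
    have hjc : j < μ.rowLen c.1 := (hcol _).2 (by omega)
    have h1 : ∑ x ∈ ({x | t.col x = j} : Finset (Fin (n + 1))).erase z,
        ρ (swap x z) (e t) = -((c.1 : F) • e t) := by
      rw [Finset.sum_congr rfl fun x hx => he.swap_apply_of_col_eq t
        (Finset.mem_erase.1 hx).1 (Finset.mem_filter.1 (Finset.mem_erase.1 hx).2).2,
        Finset.sum_const, Finset.card_erase_of_mem (by simp), t.card_filter_col, ht,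
        Nat.add_sub_cancel, smul_neg, Nat.cast_smul_eq_nsmul]
    have h2 : ∑ x ∈ ((Finset.range (μ.rowLen c.1)).erase j).biUnion
          fun i => ({x | t.col x = i} : Finset (Fin (n + 1))),
        ρ (swap x z) (e t) = (c.2 : F) • e t := by
      rw [Finset.sum_biUnion, Finset.sum_congr rfl fun i hi => he.sum_swap_apply t
        (Finset.mem_erase.1 hi).1.symm ?_, Finset.sum_const, Finset.card_erase_of_mem
        (Finset.mem_range.2 hjc), Finset.card_range, hr, Nat.add_sub_cancel,
        Nat.cast_smul_eq_nsmul]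
      · have := (hcol i).1 (Finset.mem_range.1 (Finset.mem_erase.1 hi).2)
        rw [← hj]
        omega
      · intro a _ b _ hab
        rw [Function.onFun, Finset.disjoint_left]
        intro x hx hx'
        exact hab ((Finset.mem_filter.1 hx).2.symm.trans (Finset.mem_filter.1 hx').2)
    rw [lastTranspositions, LinearMap.sum_apply, Fin.sum_castSucc_eq_sum_ne
      (fun x => ρ (swap x z) (e t)), hsplit, Finset.sum_union,
      Finset.sum_union, h1, h2, sub_smul]
    · rw [show ∀ a b w : V,
        -a + b + w - (b - a) = w from fun a b w => by abel]
      refine Submodule.sum_mem _ fun x hx => ?_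
      rw [he.map_apply]
      obtain ⟨d, hd, hd1, hd2⟩ :=
        exists_mem_lastColSpan (F := F) e (t.trans (swap x z) : Tableau μ (n + 1))
      have hx' : Tableau.col (t.trans (swap x z) : Tableau μ (n + 1)) z = t.col x := by
        simp [Tableau.col]
      rw [hx'] at hd1
      have h3 := (hcol (t.col x)).not.1 (Finset.mem_filter.1 hx).2.not_gt
      have hlt : d.1 < c.1 := by omega
      exact Submodule.mem_iSup_of_mem d (Submodule.mem_iSup_of_mem hd
        (Submodule.mem_iSup_of_mem hlt hd2))
    · rw [Finset.disjoint_left]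
      intro x hx hx'
      simp only [Finset.mem_erase, Finset.mem_filter, Finset.mem_biUnion] at hx hx'
      obtain ⟨i, hi, -, hi2⟩ := hx'
      exact hi.1 (hi2.symm.trans hx.2.2)
    · rw [Finset.disjoint_left]
      intro x hx hx'
      simp only [Finset.mem_union, Finset.mem_erase, Finset.mem_filter, Finset.mem_biUnion,
        Finset.mem_range] at hx hx'
      rcases hx with hx | ⟨i, hi, -, hi2⟩
      · omega
      · omega

theorem restrict_transpositionSum (he : IsPolytabloidFamily ρ e) :
    Representation.asAlgebraHom (ρ.comp (permEmb n)) (transpositionSum F n) =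
      algebraMap F _ (μ.residueSum F) - lastTranspositions ρ := by
  rw [← he.transpositionSum_eq, asAlgebraHom_transpositionSum_succ, add_sub_cancel_right]

theorem commute_restrict (he : IsPolytabloidFamily ρ e) :
    Commute (Representation.asAlgebraHom (ρ.comp (permEmb n)) (transpositionSum F n))
      (lastTranspositions ρ) := by
  rw [he.restrict_transpositionSum]
  exact Commute.sub_left (Algebra.commutes _ _) (Commute.refl _)

theorem restrict_apply (he : IsPolytabloidFamily ρ e) (v : V) :
    Representation.asAlgebraHom (ρ.comp (permEmb n)) (transpositionSum F n) v =
      μ.residueSum F • v + (-1 : F) • lastTranspositions ρ v := by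
  rw [he.restrict_transpositionSum, LinearMap.sub_apply, Module.algebraMap_end_apply,
    neg_one_smul, sub_eq_add_neg]

theorem aeval_restrict (he : IsPolytabloidFamily ρ e) :
    aeval (Representation.asAlgebraHom (ρ.comp (permEmb n)) (transpositionSum F n))
      (∏ c ∈ μ.removableNodes, (X - C (μ.residueSum F - ((c.2 : F) - c.1)))) = 0 := by
  refine LinearMap.ext_on_range he.span_eq_top fun t => ?_
  obtain ⟨c, hc, -, hct⟩ := exists_mem_lastColSpan (F := F) e t
  refine aeval_prod_apply_eq_zero _ (Prod.fst : ℕ × ℕ → ℕ)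
    (fun c => μ.residueSum F - ((c.2 : F) - c.1))
    (lastColSpan F e) _ (fun d hd v hv => ?_) c hc _ hct
  have h := Submodule.neg_mem _ (he.lastTranspositions_sub_mem hd hv)
  rw [he.restrict_transpositionSum, LinearMap.sub_apply, Module.algebraMap_end_apply,
    sub_smul (μ.residueSum F), sub_sub_sub_cancel_left]
  rwa [neg_sub] at h

end IsPolytabloidFamily

end YoungDiagram

/-! ### Annihilating polynomial for the induced module. -/

theorem swap_mul_swap_last {α : Type*} [DecidableEq α] {x y z : α} (hxy : x ≠ y) (hxz : x ≠ z) :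
    swap x z * swap y z = swap y z * swap x y := by
  rw [← mul_right_inj (swap y z), swap_mul_self_mul, ← mul_assoc, swap_comm y z,
    swap_mul_swap_mul_swap hxz hxy, swap_comm]

section Central

variable {F W : Type*} [Field F] [AddCommGroup W] [Module F W] {n : ℕ}

theorem transpositionSum_apply_comm (τ : Representation F (Perm (Fin n)) W) (g : Perm (Fin n))
    (w : W) :
    τ.asAlgebraHom (transpositionSum F n) (τ g w) =
      τ g (τ.asAlgebraHom (transpositionSum F n) w) := by
  -- Conjugation by `g` permutes the transpositions; listing the pairs in the order transported by
  -- `g` makes the two sums agree term by term.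
  have h1 := sum_Ioi_eq_sum_lt (fun x => g⁻¹ x) g⁻¹.injective
    (fun i j => τ (swap i j) (τ g w)) fun i j => by rw [swap_comm]
  have h2 := sum_Ioi_eq_sum_lt (fun x => x) Function.injective_id
    (fun i j => τ g (τ (swap i j) w)) fun i j => by rw [swap_comm]
  simp only [asAlgebraHom_transpositionSum, LinearMap.sum_apply, map_sum]
  rw [h1, h2, ← Equiv.sum_comp g]
  refine Finset.sum_congr rfl fun y _ => ?_
  rw [Finset.sum_filter, Finset.sum_filter, ← Equiv.sum_comp g]
  refine Finset.sum_congr rfl fun x _ => ?_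
  simp only [show ∀ x, g⁻¹ (g x) = x from fun x => g.symm_apply_apply x]
  congr 1
  rw [← Module.End.mul_apply, ← Module.End.mul_apply, ← map_mul, ← map_mul, mul_swap_eq_swap_mul]

end Central

namespace YoungDiagram

variable {μ : YoungDiagram} {n : ℕ} {F V W : Type*} [Field F] [AddCommGroup V] [Module F V]
  [AddCommGroup W] [Module F W]

/-- The operator that antisymmetrizes the `j`-th column of `t`, extended by the last letter, of a
vector that is already antisymmetric in the `j`-th column. -/
def extendCol (τ : Representation F (Perm (Fin (n + 1))) W) (t : Tableau μ n) (j : ℕ) :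
    Module.End F W :=
  1 - ∑ x with t.col x = j, τ (swap x.castSucc (Fin.last n))

theorem extendCol_apply (τ : Representation F (Perm (Fin (n + 1))) W) (t : Tableau μ n) (j : ℕ)
    (w : W) :
    extendCol τ t j w = w - ∑ x with t.col x = j, τ (swap x.castSucc (Fin.last n)) w := by
  simp [extendCol]

/-- The submodule generated by the antisymmetrizations along the columns that end just above the
node `c`. -/
def extendColSpan (τ : Representation F (Perm (Fin (n + 1))) W) (t : Tableau μ n) (w : W)
    (c : ℕ × ℕ) : Submodule F W :=
  Submodule.span F {v | ∃ g j, μ.colLen j = c.1 ∧ τ g (extendCol τ t j w) = v}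

theorem map_extendColSpan_le (τ : Representation F (Perm (Fin (n + 1))) W) (t : Tableau μ n)
    (w : W) (c : ℕ × ℕ) (g : Perm (Fin (n + 1))) :
    extendColSpan τ t w c ≤ (extendColSpan τ t w c).comap (τ g) := by
  refine Submodule.span_le.2 ?_
  rintro _ ⟨h, j, hj, rfl⟩
  refine Submodule.subset_span ⟨g * h, j, hj, ?_⟩
  rw [map_mul, Module.End.mul_apply]

namespace IsPolytabloidFamily

variable {ρ : Representation F (Perm (Fin n)) V} {e : Tableau μ n → V}
  {τ : Representation F (Perm (Fin (n + 1))) W} {ι : V →ₗ[F] W}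

theorem transpositionSum_apply (he : IsPolytabloidFamily ρ e)
    (hι : ∀ σ v, τ (permEmb n σ) (ι v) = ι (ρ σ v)) (v : V) :
    τ.asAlgebraHom (transpositionSum F (n + 1)) (ι v) =
      lastTranspositions τ (ι v) + μ.residueSum F • ι v := by
  have h := LinearMap.congr_fun he.transpositionSum_eq v
  rw [asAlgebraHom_transpositionSum, LinearMap.sum_apply, Module.algebraMap_end_apply] at h
  rw [asAlgebraHom_transpositionSum_succ, LinearMap.add_apply, add_comm, ← map_smul, ← h,
    asAlgebraHom_transpositionSum]
  simp only [LinearMap.sum_apply, map_sum, MonoidHom.comp_apply, hι]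

/-- Empty columns contribute nothing, so the bound `B` may exceed the number of columns. The slack
is needed to include an empty column that is to be extended. -/
theorem lastTranspositions_apply (t : Tableau μ n) {B : ℕ} (hB : μ.rowLen 0 ≤ B) (w : W) :
    lastTranspositions τ w = ∑ j ∈ Finset.range B, (w - extendCol τ t j w) := by
  simp only [extendCol_apply, sub_sub_cancel]
  rw [lastTranspositions, LinearMap.sum_apply, Finset.sum_fiberwise_of_maps_to]
  intro x _
  exact Finset.mem_range.2 ((t.col_lt x).trans_le ((μ.rowLen_anti _ _ (Nat.zero_le _)).trans hB))

theorem swap_extendCol (he : IsPolytabloidFamily ρ e)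
    (hι : ∀ σ v, τ (permEmb n σ) (ι v) = ι (ρ σ v)) (t : Tableau μ n) {x : Fin n} {k : ℕ}
    (hx : t.col x = k) :
    τ (swap x.castSucc (Fin.last n)) (extendCol τ t k (ι (e t))) =
      -extendCol τ t k (ι (e t)) := by
  have hmem : x ∈ ({x | t.col x = k} : Finset (Fin n)) := by simpa using hx
  rw [extendCol_apply, ← Finset.add_sum_erase _ _ hmem, map_sub, map_add, map_sum,
    ← Module.End.mul_apply, ← map_mul, swap_mul_self, map_one, Module.End.one_apply]
  have h : ∀ y ∈ ({x | t.col x = k} : Finset (Fin n)).erase x,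
      τ (swap x.castSucc (Fin.last n)) (τ (swap y.castSucc (Fin.last n)) (ι (e t))) =
        -τ (swap y.castSucc (Fin.last n)) (ι (e t)) := by
    intro y hy
    have hxy := (Finset.mem_erase.1 hy).1.symm
    rw [← Module.End.mul_apply, ← map_mul,
      swap_mul_swap_last ((Fin.castSucc_injective n).ne hxy) (Fin.castSucc_lt_last x).ne,
      map_mul, Module.End.mul_apply, ← permEmb_swap, hι, he.swap_apply_of_col_eq t hxy, map_neg,
      map_neg]
    rw [hx, (Finset.mem_filter.1 (Finset.mem_erase.1 hy).2).2]
  rw [Finset.sum_congr rfl h, Finset.sum_neg_distrib]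
  abel

theorem extendCol_extendCol_self (he : IsPolytabloidFamily ρ e)
    (hι : ∀ σ v, τ (permEmb n σ) (ι v) = ι (ρ σ v)) (t : Tableau μ n) (k : ℕ) :
    extendCol τ t k (extendCol τ t k (ι (e t))) =
      extendCol τ t k (ι (e t)) + (μ.colLen k : F) • extendCol τ t k (ι (e t)) := by
  rw [extendCol_apply τ t k (extendCol τ t k (ι (e t))),
    Finset.sum_congr rfl fun x hx => he.swap_extendCol hι t (Finset.mem_filter.1 hx).2,
    Finset.sum_const, t.card_filter_col, Nat.cast_smul_eq_nsmul, smul_neg, sub_neg_eq_add]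

/-- For `x` in column `j` and `y` in column `k`, `(y last)(x last) = (x last)(y x)`. Summed over
`y`, the Garnir relation turns this into `(x last)`, so `extendCol τ t k` kills every correction
term of `extendCol τ t j`. -/
theorem extendCol_extendCol (he : IsPolytabloidFamily ρ e)
    (hι : ∀ σ v, τ (permEmb n σ) (ι v) = ι (ρ σ v)) (t : Tableau μ n) {j k : ℕ} (hjk : j ≠ k)
    (h : μ.colLen j ≤ μ.colLen k) :
    extendCol τ t k (extendCol τ t j (ι (e t))) = extendCol τ t k (ι (e t)) := by
  rw [extendCol_apply τ t j, map_sub, map_sum, sub_eq_self]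
  refine Finset.sum_eq_zero fun x hx => ?_
  have hxj := (Finset.mem_filter.1 hx).2
  rw [extendCol_apply, sub_eq_zero]
  have h1 : ∀ y ∈ ({y | t.col y = k} : Finset (Fin n)),
      τ (swap y.castSucc (Fin.last n)) (τ (swap x.castSucc (Fin.last n)) (ι (e t))) =
        τ (swap x.castSucc (Fin.last n)) (ι (ρ (swap y x) (e t))) := by
    intro y hy
    have hyx : y ≠ x := by
      rintro rfl
      exact hjk (hxj.symm.trans (Finset.mem_filter.1 hy).2)
    rw [← Module.End.mul_apply, ← map_mul,
      swap_mul_swap_last ((Fin.castSucc_injective n).ne hyx) (Fin.castSucc_lt_last y).ne,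
      map_mul, Module.End.mul_apply, ← permEmb_swap, hι]
  rw [Finset.sum_congr rfl h1, ← map_sum, ← map_sum,
    he.sum_swap_apply t (hxj.trans_ne hjk) (hxj ▸ h)]

/-- The transposition sum is central, so it may be applied before extending column `k`. Its part `L`
is a sum over columns `j`: `j = k` yields `-c.1`, other columns no longer than `k` yield 0, and each
of the `c.2` longer ones yields 1 up to an extension of that longer column. -/
theorem transpositionSum_sub_mem (he : IsPolytabloidFamily ρ e)
    (hι : ∀ σ v, τ (permEmb n σ) (ι v) = ι (ρ σ v)) (t : Tableau μ n) {c : ℕ × ℕ}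
    (hc : c ∈ μ.addableNodes) {v : W} (hv : v ∈ extendColSpan τ t (ι (e t)) c) :
    τ.asAlgebraHom (transpositionSum F (n + 1)) v -
        (μ.residueSum F + ((c.2 : F) - c.1)) • v ∈
      ⨆ d ∈ μ.addableNodes, ⨆ _ : d.2 < c.2, extendColSpan τ t (ι (e t)) d := by
  set S := ⨆ d ∈ μ.addableNodes, ⨆ _ : d.2 < c.2, extendColSpan τ t (ι (e t)) d with hS
  have hstab : ∀ g, S ≤ S.comap (τ g) := by
    intro g
    refine iSup_le fun d => iSup_le fun hd => iSup_le fun hdc => ?_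
    refine (map_extendColSpan_le τ t _ d g).trans (Submodule.comap_mono ?_)
    exact le_iSup_of_le d (le_iSup_of_le hd (le_iSup_of_le hdc le_rfl))
  induction hv using Submodule.span_induction with
  | zero => simp
  | add x y _ _ hx hy =>
    rw [map_add, smul_add, add_sub_add_comm]
    exact Submodule.add_mem _ hx hy
  | smul a x _ hx =>
    rw [map_smul, smul_comm, ← smul_sub]
    exact Submodule.smul_mem _ _ hx
  | mem v hv =>
    obtain ⟨g, k, hk, rfl⟩ := hv
    rw [transpositionSum_apply_comm, ← map_smul, ← map_sub]
    refine hstab g ?_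
    have hcomm : τ.asAlgebraHom (transpositionSum F (n + 1)) (extendCol τ t k (ι (e t))) =
        extendCol τ t k (τ.asAlgebraHom (transpositionSum F (n + 1)) (ι (e t))) := by
      simp only [extendCol_apply, map_sub, map_sum, transpositionSum_apply_comm]
    have hcol : ∀ i, i < μ.rowLen c.1 ↔ c.1 < μ.colLen i := fun i => by
      rw [← mem_iff_lt_rowLen, mem_iff_lt_colLen]
    have hc1 := (mem_addableNodes_iff.1 hc).1
    set w := extendCol τ t k (ι (e t)) with hw
    have hterm : ∀ j ∈ Finset.range (max (μ.rowLen 0) (k + 1)),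
        extendCol τ t k (ι (e t) - extendCol τ t j (ι (e t))) =
          (if j = k then -((c.1 : F) • w) else 0) +
            if j < μ.rowLen c.1 then w - extendCol τ t k (extendCol τ t j (ι (e t))) else 0 := by
      intro j _
      rw [map_sub, ← hw]
      by_cases hjk : j = k
      · subst hjk
        rw [if_pos rfl, if_neg ((hcol j).not.2 (by omega)), add_zero, hw,
          he.extendCol_extendCol_self hι t, hk]
        abel
      · rw [if_neg hjk, zero_add]
        split_ifs with hj
        · rfl
        · rw [he.extendCol_extendCol hι t hjk (by have := (hcol j).not.1 hj; omega), sub_self]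
    have hk' : k ∈ Finset.range (max (μ.rowLen 0) (k + 1)) := by simp
    have hfilter : (Finset.range (max (μ.rowLen 0) (k + 1))).filter (· < μ.rowLen c.1) =
        Finset.range c.2 := by
      have := μ.rowLen_anti _ _ (Nat.zero_le c.1)
      ext j
      simp only [Finset.mem_filter, Finset.mem_range]
      omega
    rw [hcomm, he.transpositionSum_apply hι, map_add, map_smul, ← hw,
      lastTranspositions_apply t (le_max_left (μ.rowLen 0) (k + 1)), map_sum,
      Finset.sum_congr rfl hterm, Finset.sum_add_distrib, Finset.sum_ite_eq' , if_pos hk',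
      ← Finset.sum_filter, hfilter, Finset.sum_sub_distrib, Finset.sum_const, Finset.card_range,
      add_smul, sub_smul, ← Nat.cast_smul_eq_nsmul F]
    rw [show ∀ a b r s : W, -a + (b - s) + r - (r + (b - a)) = -s from fun a b r s => by abel]
    refine Submodule.neg_mem _ (Submodule.sum_mem _ fun j hj => ?_)
    have hjc : j < c.2 := Finset.mem_range.1 hj
    have hmem : extendCol τ t j (ι (e t)) ∈ S := by
      have hlt : (μ.colLen j, μ.rowLen (μ.colLen j)).2 < c.2 := by
        have h1 : ¬ (μ.colLen j, j) ∈ μ := mem_iff_lt_colLen.not.2 (lt_irrefl _)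
        have h2 := mem_iff_lt_rowLen.not.1 h1
        dsimp only
        omega
      refine Submodule.mem_iSup_of_mem _ (Submodule.mem_iSup_of_mem (addable_colLen j)
        (Submodule.mem_iSup_of_mem hlt (Submodule.subset_span ⟨1, j, rfl, ?_⟩)))
      rw [map_one, Module.End.one_apply]
    rw [extendCol_apply]
    exact Submodule.sub_mem _ hmem (Submodule.sum_mem _ fun x _ => hstab _ hmem)

theorem aeval_induced (he : IsPolytabloidFamily ρ e)
    (hι : ∀ σ v, τ (permEmb n σ) (ι v) = ι (ρ σ v))
    (hspan : Submodule.span F (Set.range fun p : Perm (Fin (n + 1)) × V => τ p.1 (ι p.2)) = ⊤) :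
    aeval (τ.asAlgebraHom (transpositionSum F (n + 1)))
      (∏ c ∈ μ.addableNodes, (X - C (μ.residueSum F + ((c.2 : F) - c.1)))) = 0 := by
  refine LinearMap.ext_on_range hspan fun ⟨g, v⟩ => ?_
  have hlin : aeval (τ.asAlgebraHom (transpositionSum F (n + 1)))
      (∏ c ∈ μ.addableNodes, (X - C (μ.residueSum F + ((c.2 : F) - c.1)))) ∘ₗ τ g ∘ₗ ι = 0 := by
    refine LinearMap.ext_on_range he.span_eq_top fun t => ?_
    -- Column `rowLen 0` is empty, so extending it is the identity and the generator itself lies in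
    -- the subspace of the top addable node.
    refine aeval_prod_apply_eq_zero _ (Prod.snd : ℕ × ℕ → ℕ)
      (fun c => μ.residueSum F + ((c.2 : F) - c.1))
      (extendColSpan τ t (ι (e t))) _ (fun d hd v hv => ?_) _ (addable_colLen (μ.rowLen 0)) _ ?_
    · exact he.transpositionSum_sub_mem hι t hd hv
    · refine Submodule.subset_span ⟨g, μ.rowLen 0, rfl, ?_⟩
      have h0 : ({x | t.col x = μ.rowLen 0} : Finset (Fin n)) = ∅ := by
        refine Finset.filter_eq_empty_iff.2 fun x _ => ?_
        exact ((t.col_lt x).trans_le (μ.rowLen_anti _ _ (Nat.zero_le _))).ne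
      rw [extendCol_apply, h0, Finset.sum_empty, sub_zero]
      rfl
  exact LinearMap.congr_fun hlin v

end IsPolytabloidFamily

end YoungDiagram

/-! ### Lower bound for the degree, by row assignments. -/

/-- A criterion for a polynomial in `D` not to vanish on `v`, by comparison with the powers of an
operator `L` that acts on `v` as an affine function of `D`. -/
theorem aeval_apply_ne_zero {F V : Type*} [Field F] [AddCommGroup V] [Module F V]
    {D L : Module.End F V} (hDL : Commute D L) {v : V} {a s : F} (hs : s ≠ 0)
    (hv : D v = a • v + s • L v) (φ : V →ₗ[F] F) {k : ℕ} (hlt : ∀ j < k, φ ((L ^ j) v) = 0)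
    (hk : φ ((L ^ k) v) ≠ 0) {q : F[X]} (hq : q ≠ 0) (hdeg : q.natDegree ≤ k) :
    aeval D q v ≠ 0 := by
  set A : F[X] := C s * X + C a with hA
  have hAdeg : A.natDegree = 1 := natDegree_linear hs
  -- Since `D` commutes with `L`, the affine relation on `v` passes to all powers, so `q(D) v = (q ∘
  -- A)(L) v`; composing with the linear polynomial `A` preserves the degree.
  have hpow : ∀ i, (D ^ i) v = aeval L (A ^ i) v := by
    intro i
    induction i with
    | zero => simp
    | succ i ih =>
      have hc : Commute D (aeval L (A ^ i)) := by
        rw [map_pow, hA, map_add, map_mul, aeval_C, aeval_C, aeval_X]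
        exact (((show Commute D (algebraMap F _ s) from (Algebra.commutes s D).symm).mul_right
          hDL).add_right (Algebra.commutes a D).symm).pow_right i
      have h1 : D v = aeval L A v := by
        rw [hv, hA]
        simp [Module.algebraMap_end_apply, add_comm]
      rw [pow_succ', Module.End.mul_apply, ih, ← Module.End.mul_apply, hc.eq,
        Module.End.mul_apply, h1, ← Module.End.mul_apply, ← map_mul, pow_succ]
  have hcomp : aeval D q v = aeval L (q.comp A) v := by
    rw [aeval_eq_sum_range, comp_eq_sum_left, sum_over_range _ (by simp), map_sum,
      LinearMap.sum_apply, LinearMap.sum_apply]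
    refine Finset.sum_congr rfl fun i _ => ?_
    rw [LinearMap.smul_apply, hpow, map_mul, aeval_C, Module.End.mul_apply,
      Module.algebraMap_end_apply]
  have hAC : A ≠ C (A.coeff 0) := fun h => by
    rw [h, natDegree_C] at hAdeg
    exact zero_ne_one hAdeg
  have hr : q.comp A ≠ 0 := fun h => by
    rcases comp_eq_zero_iff.1 h with h | h
    · exact hq h
    · exact hAC h.2
  have hrdeg : (q.comp A).natDegree = q.natDegree := by rw [natDegree_comp, hAdeg, mul_one]
  intro h0
  rw [hcomp, aeval_eq_sum_range] at h0
  -- This power of `L` lifts the leading term to exponent `k` and leaves all others below `k`, where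
  -- `φ` vanishes.
  have h1 := congrArg (fun w => φ ((L ^ (k - q.natDegree)) w)) h0
  simp only [LinearMap.sum_apply, LinearMap.smul_apply, map_sum, map_smul, map_zero,
    ← Module.End.mul_apply, ← pow_add] at h1
  rw [Finset.sum_range_succ, Finset.sum_eq_zero, zero_add, hrdeg, Nat.sub_add_cancel hdeg,
    smul_eq_mul, mul_eq_zero, or_iff_left hk, ← hrdeg] at h1
  · exact hr (leadingCoeff_eq_zero.1 h1)
  · intro i hi
    rw [hlt, smul_zero]
    have := Finset.mem_range.1 hi
    omega

/-- The representation of the symmetric group on functions of row assignments. -/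
def placementRep (F : Type*) [Field F] (N : ℕ) :
    Representation F (Perm (Fin N)) ((Fin N → ℕ) → F) where
  toFun σ := LinearMap.funLeft F F fun f : Fin N → ℕ => f ∘ σ
  map_one' := rfl
  map_mul' _ _ := rfl

theorem placementRep_apply {F : Type*} [Field F] {N : ℕ} (σ : Perm (Fin N))
    (w : (Fin N → ℕ) → F) (f : Fin N → ℕ) : placementRep F N σ w f = w (f ∘ σ) := rfl

theorem lastTranspositions_placementRep_apply {F : Type*} [Field F] {N : ℕ}
    (w : (Fin (N + 1) → ℕ) → F) (f : Fin (N + 1) → ℕ) :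
    lastTranspositions (placementRep F (N + 1)) w f =
      ∑ y with y ≠ Fin.last N, w (f ∘ swap y (Fin.last N)) := by
  rw [← Fin.sum_castSucc_eq_sum_ne (fun y => w (f ∘ swap y (Fin.last N))), lastTranspositions,
    LinearMap.sum_apply, Finset.sum_apply]
  rfl

section Placement

variable {N : ℕ} (row col : Fin (N + 1) → ℕ)

/-- The letters of the column of `x` do not occupy the same rows in the row assignment `f` as they
do originally. -/
def IsBad (f : Fin (N + 1) → ℕ) (x : Fin (N + 1)) : Prop :=
  ({w | col w = col x} : Finset (Fin (N + 1))).image f ≠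
    ({w | col w = col x} : Finset (Fin (N + 1))).image row

variable {row col}

theorem IsBad.comp_swap {f : Fin (N + 1) → ℕ} {x y z : Fin (N + 1)} (h : IsBad row col f x)
    (hy : col x ≠ col y) (hz : col x ≠ col z) : IsBad row col (f ∘ swap y z) x := by
  rw [IsBad] at h ⊢
  convert h using 1
  refine Finset.image_congr fun w hw => ?_
  have hwx : col w = col x := by simpa using hw
  rw [Function.comp_apply, swap_apply_of_ne_of_ne]
  · rintro rfl; exact hy hwx.symm
  · rintro rfl; exact hz hwx.symm

theorem isBad_of_lt {f : Fin (N + 1) → ℕ} {x : Fin (N + 1)} (h : row x < f x)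
    (hmax : ∀ w, col w = col x → row w ≤ row x) : IsBad row col f x := by
  intro he
  have h1 : f x ∈ ({w | col w = col x} : Finset (Fin (N + 1))).image f :=
    Finset.mem_image_of_mem f (by simp)
  rw [he, Finset.mem_image] at h1
  obtain ⟨w, hw, hwx⟩ := h1
  have := hmax w (by simpa using hw)
  omega

theorem isBad_of_forall_ne {f : Fin (N + 1) → ℕ} {x : Fin (N + 1)}
    (h : ∀ w, col w = col x → f w ≠ row x) : IsBad row col f x := by
  intro he
  have h1 : row x ∈ ({w | col w = col x} : Finset (Fin (N + 1))).image row :=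
    Finset.mem_image_of_mem row (by simp)
  rw [← he, Finset.mem_image] at h1
  obtain ⟨w, hw, hwx⟩ := h1
  exact h w (by simpa using hw) hwx

variable {F H : Type*} [Field F] [Group H] (row col)

/-- The signed sum over column-preserving permutations, as a function of row assignments. -/
def signedSum (G : Finset H) (s : H → F) (emb : H →* Perm (Fin (N + 1)))
    (f : Fin (N + 1) → ℕ) : F :=
  ∑ π ∈ G, if f ∘ emb π = row then s π else 0

variable {row col} {G : Finset H} {s : H → F} {emb : H →* Perm (Fin (N + 1))}

theorem signedSum_eq_zero (hG : ∀ π ∈ G, ∀ x, col (emb π x) = col x) {f : Fin (N + 1) → ℕ}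
    {x : Fin (N + 1)} (h : IsBad row col f x) : signedSum row G s emb f = 0 := by
  refine Finset.sum_eq_zero fun π hπ => if_neg fun he => h ?_
  rw [← he]
  ext r
  simp only [Finset.mem_image, Finset.mem_filter, Finset.mem_univ, true_and, Function.comp_apply]
  constructor
  · rintro ⟨w, hw, rfl⟩
    refine ⟨(emb π).symm w, ?_, by rw [apply_symm_apply]⟩
    rw [← hG π hπ, apply_symm_apply, hw]
  · rintro ⟨w, hw, rfl⟩
    exact ⟨emb π w, by rw [hG π hπ, hw], rfl⟩

theorem signedSum_self (hG : ∀ π ∈ G, ∀ x, col (emb π x) = col x) (hemb : Function.Injective emb)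
    (h1 : 1 ∈ G) (hs : s 1 = 1) (hinj : ∀ x y, row x = row y → col x = col y → x = y) :
    signedSum row G s emb row = 1 := by
  rw [signedSum, Finset.sum_eq_single_of_mem 1 h1, if_pos (by rw [map_one]; rfl), hs]
  intro π hπ hne
  refine if_neg fun he => hne (hemb ?_)
  rw [map_one]
  exact Equiv.ext fun x => hinj _ _ (congrFun he x) (hG π hπ x)

/-- A transposition of `y` with the last letter can only repair the column of `y` among those
represented in `A`. With fewer steps than bad columns, some column stays bad and the signed sum
vanishes. -/
theorem pow_lastTranspositions_signedSum_eq_zero (hG : ∀ π ∈ G, ∀ x, col (emb π x) = col x)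
    (k : ℕ) (f : Fin (N + 1) → ℕ) (A : Finset (Fin (N + 1))) (hA : ∀ x ∈ A, IsBad row col f x)
    (hAz : ∀ x ∈ A, col x ≠ col (Fin.last N)) (hAc : Set.InjOn col A) (hk : k < A.card) :
    (lastTranspositions (placementRep F (N + 1)) ^ k) (signedSum row G s emb) f = 0 := by
  induction k generalizing f A with
  | zero =>
    obtain ⟨x, hx⟩ := Finset.card_pos.1 hk
    exact signedSum_eq_zero hG (hA x hx)
  | succ k ih =>
    rw [pow_succ', Module.End.mul_apply, lastTranspositions_placementRep_apply]
    refine Finset.sum_eq_zero fun y _ => ih _ (A.filter fun x => col x ≠ col y) ?_ ?_ ?_ ?_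
    · intro x hx
      have hx := Finset.mem_filter.1 hx
      exact (hA x hx.1).comp_swap hx.2 (hAz x hx.1)
    · exact fun x hx => hAz x (Finset.mem_filter.1 hx).1
    · exact hAc.mono fun x hx => (Finset.mem_filter.1 hx).1
    · have h1 : (A.filter fun x => ¬ col x ≠ col y).card ≤ 1 := by
        refine Finset.card_le_one.2 fun a ha b hb => ?_
        simp only [Finset.mem_filter, not_not] at ha hb
        exact hAc ha.1 hb.1 (ha.2.trans hb.2.symm)
      have h2 := Finset.card_filter_add_card_filter_not (s := A) (fun x => col x ≠ col y)
      omega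

variable (row) in
/-- The row assignment obtained by exchanging the last letter successively with the letters of a
list, the last one first. -/
def shiftAlong : List (Fin (N + 1)) → Fin (N + 1) → ℕ
  | [] => row
  | x :: xs => shiftAlong xs ∘ swap x (Fin.last N)

variable (row col) in
/-- A list of letters below which there is nothing in their columns, in distinct columns and with
increasing rows above that of the last letter. -/
def IsColumnEndChain (xs : List (Fin (N + 1))) : Prop :=
  xs.Pairwise (fun x y => row x < row y ∧ col x ≠ col y) ∧
    ∀ x ∈ xs, row x < row (Fin.last N) ∧ col x ≠ col (Fin.last N) ∧
      ∀ w, col w = col x → row w ≤ row x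

theorem IsColumnEndChain.tail {x : Fin (N + 1)} {xs : List (Fin (N + 1))} (h : IsColumnEndChain row col (x :: xs)) :
    IsColumnEndChain row col xs :=
  ⟨(List.pairwise_cons.1 h.1).2, fun y hy => h.2 y (List.mem_cons_of_mem x hy)⟩

theorem shiftAlong_of_notMem {xs : List (Fin (N + 1))} {w : Fin (N + 1)} (hw : w ∉ xs)
    (hwz : w ≠ Fin.last N) : shiftAlong row xs w = row w := by
  induction xs with
  | nil => rfl
  | cons x xs ih =>
    rw [List.mem_cons, not_or] at hw
    rw [shiftAlong, Function.comp_apply, swap_apply_of_ne_of_ne hw.1 hwz, ih hw.2]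

theorem IsColumnEndChain.ne_last {xs : List (Fin (N + 1))} (h : IsColumnEndChain row col xs) {x : Fin (N + 1)}
    (hx : x ∈ xs) : x ≠ Fin.last N := by
  rintro rfl
  exact (h.2 _ hx).2.1 rfl

theorem shiftAlong_cons_last {x : Fin (N + 1)} {xs : List (Fin (N + 1))}
    (h : IsColumnEndChain row col (x :: xs)) : shiftAlong row (x :: xs) (Fin.last N) = row x := by
  rw [shiftAlong, Function.comp_apply, swap_apply_right]
  exact shiftAlong_of_notMem (fun hx => ((List.pairwise_cons.1 h.1).1 x hx).2 rfl)
    (h.ne_last List.mem_cons_self)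

/-- Each letter of the chain takes the row of its successor, the final one that of the last letter.
As each is the lowest in its column, its new row does not occur there. -/
theorem lt_shiftAlong {xs : List (Fin (N + 1))} (h : IsColumnEndChain row col xs) :
    ∀ x ∈ xs, row x < shiftAlong row xs x := by
  induction xs with
  | nil => simp
  | cons x xs ih =>
    intro y hy
    rw [shiftAlong, Function.comp_apply]
    by_cases hyx : y = x
    · subst hyx
      rw [swap_apply_left]
      cases xs with
      | nil => exact (h.2 y hy).1
      | cons x' xs =>
        rw [shiftAlong_cons_last h.tail]
        exact ((List.pairwise_cons.1 h.1).1 x' List.mem_cons_self).1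
    · rw [swap_apply_of_ne_of_ne hyx (h.ne_last hy)]
      exact ih h.tail y ((List.mem_cons.1 hy).resolve_left hyx)

theorem IsColumnEndChain.isBad {xs : List (Fin (N + 1))} (h : IsColumnEndChain row col xs) {x : Fin (N + 1)}
    (hx : x ∈ xs) : IsBad row col (shiftAlong row xs) x :=
  isBad_of_lt (lt_shiftAlong h x hx) (h.2 x hx).2.2

theorem IsColumnEndChain.injOn {xs : List (Fin (N + 1))} (h : IsColumnEndChain row col xs) :
    Set.InjOn col (xs.toFinset : Set (Fin (N + 1))) := by
  intro a ha b hb hab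
  have hp : (xs.map col).Nodup := List.pairwise_map.2 (h.1.imp fun h => h.2)
  exact List.inj_on_of_nodup_map hp (by simpa using ha) (by simpa using hb) hab

theorem IsColumnEndChain.nodup {xs : List (Fin (N + 1))} (h : IsColumnEndChain row col xs) : xs.Nodup :=
  h.1.imp fun h he => h.2 (congrArg col he)

theorem pow_lastTranspositions_signedSum_of_lt (hG : ∀ π ∈ G, ∀ x, col (emb π x) = col x)
    {xs : List (Fin (N + 1))} (h : IsColumnEndChain row col xs) {k : ℕ} (hk : k < xs.length) :
    (lastTranspositions (placementRep F (N + 1)) ^ k) (signedSum row G s emb)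
      (shiftAlong row xs) = 0 := by
  refine pow_lastTranspositions_signedSum_eq_zero hG k _ xs.toFinset
    (fun x hx => h.isBad (List.mem_toFinset.1 hx))
    (fun x hx => (h.2 x (List.mem_toFinset.1 hx)).2.1) h.injOn ?_
  rwa [List.toFinset_card_of_nodup h.nodup]

theorem pow_lastTranspositions_signedSum (hG : ∀ π ∈ G, ∀ x, col (emb π x) = col x)
    (hemb : Function.Injective emb) (h1 : 1 ∈ G) (hs : s 1 = 1)
    (hinj : ∀ x y, row x = row y → col x = col y → x = y) {xs : List (Fin (N + 1))}
    (h : IsColumnEndChain row col xs) :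
    (lastTranspositions (placementRep F (N + 1)) ^ xs.length) (signedSum row G s emb)
      (shiftAlong row xs) = 1 := by
  induction xs with
  | nil => exact signedSum_self hG hemb h1 hs hinj
  | cons x xs ih =>
    rw [List.length_cons, pow_succ', Module.End.mul_apply, lastTranspositions_placementRep_apply,
      Finset.sum_eq_single_of_mem x
        (Finset.mem_filter.2 ⟨Finset.mem_univ _, h.ne_last List.mem_cons_self⟩)]
    · rw [← ih h.tail]
      rw [shiftAlong, Function.comp_assoc, ← Perm.coe_mul, swap_mul_self]
      rfl
    -- Any first swap other than with the head of the chain leaves every column of the chain bad,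
    -- and one step too few remains.
    · intro y hyz hyx
      refine pow_lastTranspositions_signedSum_eq_zero hG _ _ (x :: xs).toFinset ?_
        (fun x hx => (h.2 x (List.mem_toFinset.1 hx)).2.1) h.injOn ?_
      · intro x₀ hx₀
        have hyz : y ≠ Fin.last N := (Finset.mem_filter.1 hyz).2
        have hx₀' := List.mem_toFinset.1 hx₀
        by_cases hc : col x₀ = col y
        · by_cases hy : y = x₀
          · subst hy
            -- Here `y` is a later letter of the chain: it receives the row of the head, strictly
            -- above its own, and no other letter of its column fills its original row.
            refine isBad_of_forall_ne fun w hw => ?_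
            rw [Function.comp_apply]
            by_cases hwy : w = y
            · subst hwy
              rw [swap_apply_left, shiftAlong_cons_last h]
              exact ((List.pairwise_cons.1 h.1).1 w
                ((List.mem_cons.1 hx₀').resolve_left hyx)).1.ne
            · have hwz : w ≠ Fin.last N := by
                rintro rfl
                exact (h.2 y hx₀').2.1 hw.symm
              rw [swap_apply_of_ne_of_ne hwy hwz, shiftAlong_of_notMem _ hwz]
              · exact fun hr => hwy (hinj _ _ hr hw)
              · exact fun hwx => hwy (h.injOn (by simpa using hwx) (by simpa using hx₀') hw)
          · refine isBad_of_lt ?_ (h.2 x₀ hx₀').2.2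
            rw [Function.comp_apply, swap_apply_of_ne_of_ne (Ne.symm hy) (h.ne_last hx₀')]
            exact lt_shiftAlong h x₀ hx₀'
        · exact (h.isBad hx₀').comp_swap hc (h.2 x₀ hx₀').2.1
      · rw [List.toFinset_card_of_nodup h.nodup, List.length_cons]
        exact Nat.lt_succ_self _

end Placement

/-- A finset can be listed in the order of an injective key. -/
theorem Finset.exists_list_pairwise_lt {α : Type*} [DecidableEq α] (key : α → ℕ) (A : Finset α)
    (h : Set.InjOn key A) :
    ∃ l : List α, l.Pairwise (fun x y => key x < key y) ∧ l.toFinset = A := by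
  induction A using Finset.induction_on_min_value key with
  | empty => exact ⟨[], List.Pairwise.nil, rfl⟩
  | insert a s ha hmin ih =>
    obtain ⟨l, hl, rfl⟩ := ih (h.mono (by simp))
    refine ⟨a :: l, List.pairwise_cons.2 ⟨fun x hx => ?_, hl⟩, by simp⟩
    have hx' := List.mem_toFinset.2 hx
    refine (hmin x hx').lt_of_ne fun he => ha ?_
    rwa [h (by simp) (by simp [hx]) he]

/-! ### Polytabloids as signed sums on row assignments, and letters at removable nodes. -/

namespace YoungDiagram

variable {μ : YoungDiagram} {n N : ℕ} (F : Type*) [Field F]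

/-- The linear map that sends a tabloid to the indicator function of a row assignment. -/
noncomputable def tabloidPlacement (h : Tabloid μ n → Fin N → ℕ) :
    MonoidAlgebra F (Tabloid μ n) →ₗ[F] ((Fin N → ℕ) → F) :=
  Finsupp.linearCombination F (fun T => Pi.single (h T) (1 : F)) ∘ₗ
    (MonoidAlgebra.coeffLinearEquiv F).toLinearMap

theorem tabloidPlacement_single (h : Tabloid μ n → Fin N → ℕ) (T : Tabloid μ n) (a : F) :
    tabloidPlacement F h (MonoidAlgebra.single T a) = a • Pi.single (h T) (1 : F) := by
  simp [tabloidPlacement]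

variable {h : Tabloid μ n → Fin N → ℕ} {emb : Perm (Fin n) →* Perm (Fin N)}

theorem tabloidPlacement_permRep (hemb : ∀ σ T, h (σ • T) ∘ emb σ = h T) (σ : Perm (Fin n))
    (v : MonoidAlgebra F (Tabloid μ n)) :
    tabloidPlacement F h (permRep F μ n σ v) =
      placementRep F N (emb σ) (tabloidPlacement F h v) := by
  suffices H : tabloidPlacement F h ∘ₗ permRep F μ n σ =
      placementRep F N (emb σ) ∘ₗ tabloidPlacement F h from LinearMap.congr_fun H v
  refine MonoidAlgebra.lhom_ext' fun T => LinearMap.ext fun a => ?_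
  rw [LinearMap.comp_apply, LinearMap.comp_apply, LinearMap.comp_apply, LinearMap.comp_apply,
    MonoidAlgebra.lsingle_apply, Representation.ofMulAction_single,
    tabloidPlacement_single, tabloidPlacement_single, map_smul]
  congr 1
  ext f
  rw [placementRep_apply, Pi.single_apply, Pi.single_apply, ← hemb σ T]
  congr 1
  exact propext ⟨fun H => by rw [H], fun H => (emb σ).surjective.injective_comp_right H⟩

theorem tabloidPlacement_polytabloid {n N : ℕ} {h : Tabloid μ n → Fin (N + 1) → ℕ}
    {emb : Perm (Fin n) →* Perm (Fin (N + 1))} (hemb : ∀ σ T, h (σ • T) ∘ emb σ = h T)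
    (t : Tableau μ n) :
    tabloidPlacement F h (t.polytabloid F) =
      signedSum (h t.tabloid) t.colStabilizer (fun π => ((Perm.sign π : ℤ) : F)) emb := by
  ext f
  rw [Tableau.polytabloid, map_sum, Finset.sum_apply]
  refine Finset.sum_congr rfl fun π _ => ?_
  rw [tabloidPlacement_single, Pi.smul_apply, Pi.single_apply, ← hemb π t.tabloid, smul_ite,
    smul_eq_mul, mul_one, smul_zero]
  congr 1
  exact propext ⟨fun H => by rw [H], fun H => (emb π).surjective.injective_comp_right H⟩

variable {F}

theorem Tableau.eq_of_removable (t : Tableau μ n) {x y : Fin n}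
    (hx : (t.symm x).1 ∈ μ.removableNodes) (hy : (t.symm y).1 ∈ μ.removableNodes)
    (hxy : t.row x = t.row y ∨ t.col x = t.col y) : x = y := by
  have h1 := mem_removableNodes_iff.1 hx
  have h2 := mem_removableNodes_iff.1 hy
  change μ.rowLen (t.row x) = t.col x + 1 ∧ μ.colLen (t.col x) = t.row x + 1 at h1
  change μ.rowLen (t.row y) = t.col y + 1 ∧ μ.colLen (t.col y) = t.row y + 1 at h2
  rcases hxy with hxy | hxy
  · rw [hxy] at h1
    exact t.eq_of_row_of_col hxy (by omega)
  · rw [hxy] at h1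
    exact t.eq_of_row_of_col (by omega) hxy

/-- Letters at removable nodes can be listed in the order of their rows. -/
theorem Tableau.exists_list_removable (t : Tableau μ n) (A : Finset (Fin n))
    (hA : ∀ x ∈ A, (t.symm x).1 ∈ μ.removableNodes) :
    ∃ l : List (Fin n), l.Pairwise (fun x y => t.row x < t.row y ∧ t.col x ≠ t.col y) ∧
      l.toFinset = A ∧ l.length = A.card := by
  obtain ⟨l, hl, rfl⟩ := Finset.exists_list_pairwise_lt t.row A
    fun x hx y hy hxy => t.eq_of_removable (hA x hx) (hA y hy) (Or.inl hxy)
  have hnd : l.Nodup := hl.imp fun h he => h.ne (congrArg t.row he)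
  refine ⟨l, ?_, rfl, (List.toFinset_card_of_nodup hnd).symm⟩
  refine hl.imp_of_mem fun {x y} hx hy hxy => ⟨hxy, fun hc => hxy.ne ?_⟩
  rw [t.eq_of_removable (hA x (List.mem_toFinset.2 hx)) (hA y (List.mem_toFinset.2 hy)) (Or.inr hc)]

theorem Tableau.card_filter_removable (t : Tableau μ n) :
    ({x | (t.symm x).1 ∈ μ.removableNodes} : Finset (Fin n)).card = μ.removableNodes.card := by
  refine Finset.card_bij (fun x _ => (t.symm x).1) ?_ ?_ ?_
  · exact fun x hx => (Finset.mem_filter.1 hx).2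
  · exact fun x _ y _ h => t.symm.injective (Subtype.ext h)
  · intro c hc
    exact ⟨t ⟨c, (mem_removableNodes.1 hc).1⟩,
      Finset.mem_filter.2 ⟨Finset.mem_univ _, by simpa using hc⟩, by simp⟩

theorem Tableau.row_le_of_removable (t : Tableau μ n) {x w : Fin n}
    (hx : (t.symm x).1 ∈ μ.removableNodes) (hw : t.col w = t.col x) : t.row w ≤ t.row x := by
  have h1 := (mem_removableNodes_iff.1 hx).2
  have h2 := t.row_lt w
  rw [hw] at h2
  change μ.colLen (t.col x) = t.row x + 1 at h1
  omega

end YoungDiagram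

section Intertwining

variable {F V : Type*} [Field F] [AddCommGroup V] [Module F V] {N : ℕ}

theorem intertwine_pow_lastTranspositions {τ : Representation F (Perm (Fin (N + 1))) V}
    {Ψ : V →ₗ[F] ((Fin (N + 1) → ℕ) → F)}
    (hΨ : ∀ g v, Ψ (τ g v) = placementRep F (N + 1) g (Ψ v)) (k : ℕ) (v : V) :
    Ψ ((lastTranspositions τ ^ k) v) =
      (lastTranspositions (placementRep F (N + 1)) ^ k) (Ψ v) := by
  induction k with
  | zero => rfl
  | succ k ih =>
    rw [pow_succ', pow_succ', Module.End.mul_apply, Module.End.mul_apply, ← ih,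
      lastTranspositions, lastTranspositions, LinearMap.sum_apply, LinearMap.sum_apply, map_sum]
    exact Finset.sum_congr rfl fun i _ => hΨ _ _

/-- Common form of both lower bounds: `emb` is the identity for the restriction and `permEmb` for
the induced module. -/
theorem aeval_ne_zero_of_signedSum {H : Type*} [Group H]
    {τ : Representation F (Perm (Fin (N + 1))) V} {Ψ : V →ₗ[F] ((Fin (N + 1) → ℕ) → F)}
    (hΨ : ∀ g v, Ψ (τ g v) = placementRep F (N + 1) g (Ψ v)) {row col : Fin (N + 1) → ℕ}
    {G : Finset H} {s : H → F} {emb : H →* Perm (Fin (N + 1))}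
    (hG : ∀ π ∈ G, ∀ x, col (emb π x) = col x) (hemb : Function.Injective emb) (h1 : 1 ∈ G)
    (hs : s 1 = 1) (hinj : ∀ x y, row x = row y → col x = col y → x = y)
    {xs : List (Fin (N + 1))} (h : IsColumnEndChain row col xs) {v : V}
    (hv : Ψ v = signedSum row G s emb) {D : Module.End F V}
    (hD : Commute D (lastTranspositions τ)) {a b : F} (hb : b ≠ 0)
    (hDv : D v = a • v + b • lastTranspositions τ v) {q : F[X]} (hq : q ≠ 0)
    (hdeg : q.natDegree ≤ xs.length) : aeval D q ≠ 0 := by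
  intro h0
  refine aeval_apply_ne_zero hD hb hDv (LinearMap.proj (shiftAlong row xs) ∘ₗ Ψ) (fun j hj => ?_)
    ?_ hq hdeg (LinearMap.congr_fun h0 v)
  · rw [LinearMap.comp_apply, intertwine_pow_lastTranspositions hΨ, hv]
    exact pow_lastTranspositions_signedSum_of_lt hG h hj
  · rw [LinearMap.comp_apply, intertwine_pow_lastTranspositions hΨ, hv, LinearMap.proj_apply,
      pow_lastTranspositions_signedSum hG hemb h1 hs hinj h]
    exact one_ne_zero

theorem minpoly_eq_prod {ι : Type*} {D : Module.End F V} (A : Finset ι) (a : ι → F)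
    (h0 : aeval D (∏ i ∈ A, (X - C (a i))) = 0)
    (hne : ∀ q : F[X], q ≠ 0 → q.natDegree < A.card → aeval D q ≠ 0) :
    minpoly F D = ∏ i ∈ A, (X - C (a i)) := by
  refine (minpoly.unique F D (monic_prod_X_sub_C a A) h0 fun q hq hq0 => ?_).symm
  have h1 : A.card ≤ q.natDegree := by
    by_contra hlt
    exact hne q hq.ne_zero (not_le.1 hlt) hq0
  rw [degree_eq_natDegree (monic_prod_X_sub_C a A).ne_zero, degree_eq_natDegree hq.ne_zero,
    natDegree_finsetProd_X_sub_C_eq_card]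
  exact_mod_cast h1

end Intertwining

/-! ### Generators and universal property of the induced representation. -/

section Induction

open Representation

variable {F G H A W : Type*} [Field F] [Group G] [Group H] [AddCommGroup A] [Module F A]
  [AddCommGroup W] [Module F W] {φ : G →* H} {ρ : Representation F G A}

theorem indV_mk_mul (g : G) (h : H) (a : A) :
    IndV.mk φ ρ (φ g * h) (ρ g a) = IndV.mk φ ρ h a := by
  have := Coinvariants.mk_self_apply (Representation.tprod ((leftRegular F H).comp φ) ρ) g
    (TensorProduct.mk F _ _ (MonoidAlgebra.single h 1) a)
  simpa using this

theorem ind_apply_mk_one (g : G) (a : A) :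
    Representation.ind φ ρ (φ g) (IndV.mk φ ρ 1 a) = IndV.mk φ ρ 1 (ρ g a) := by
  rw [ind_mk, ← indV_mk_mul g (1 * (φ g)⁻¹) a, one_mul, mul_inv_cancel]

theorem span_ind_mk_one :
    Submodule.span F (Set.range fun p : H × A =>
      Representation.ind φ ρ p.1 (IndV.mk φ ρ 1 p.2)) = ⊤ := by
  set S := Submodule.span F (Set.range fun p : H × A =>
      Representation.ind φ ρ p.1 (IndV.mk φ ρ 1 p.2)) with hS
  have h0 : S.mkQ = 0 := by
    refine IndV.hom_ext φ ρ fun h => LinearMap.ext fun a => ?_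
    rw [LinearMap.comp_apply, LinearMap.zero_comp, LinearMap.zero_apply, Submodule.mkQ_apply,
      Submodule.Quotient.mk_eq_zero]
    refine Submodule.subset_span ⟨(h⁻¹, a), ?_⟩
    dsimp only
    rw [ind_mk, one_mul, inv_inv]
  rw [← S.ker_mkQ, h0, LinearMap.ker_zero]

/-- Frobenius reciprocity: an equivariant map to a representation of the larger group extends to
the induced representation. -/
theorem exists_ind_lift (π : Representation F H W) (f : A →ₗ[F] W)
    (hf : ∀ g a, f (ρ g a) = π (φ g) (f a)) :
    ∃ Ψ : IndV φ ρ →ₗ[F] W, (∀ a, Ψ (IndV.mk φ ρ 1 a) = f a) ∧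
      ∀ h v, Ψ (Representation.ind φ ρ h v) = π h (Ψ v) := by
  have hmul : ∀ (a b : H) (w : W), π (a * b) w = π a (π b w) := fun a b w => by
    rw [map_mul, Module.End.mul_apply]
  let Ψ₀ : TensorProduct F (MonoidAlgebra F H) A →ₗ[F] W := TensorProduct.lift
    ((Finsupp.lift (A →ₗ[F] W) F H fun h => π h⁻¹ ∘ₗ f) ∘ₗ
      (MonoidAlgebra.coeffLinearEquiv F).toLinearMap)
  have hΨ₀ : ∀ h a, Ψ₀ (TensorProduct.tmul F (MonoidAlgebra.single h 1) a) = π h⁻¹ (f a) := by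
    intro h a
    simp [Ψ₀]
  let Ψ : IndV φ ρ →ₗ[F] W := Coinvariants.lift _ Ψ₀ fun g => by
    refine TensorProduct.ext <| MonoidAlgebra.lhom_ext' fun h => LinearMap.ext_ring <|
      LinearMap.ext fun a => ?_
    have h1 := hΨ₀ (φ g * h) (ρ g a)
    rw [hf, mul_inv_rev, ← hmul, inv_mul_cancel_right, ← hΨ₀] at h1
    simpa using h1
  have hΨ : ∀ h a, Ψ (IndV.mk φ ρ h a) = π h⁻¹ (f a) := hΨ₀
  refine ⟨Ψ, fun a => by rw [hΨ, inv_one, map_one, Module.End.one_apply], fun h => ?_⟩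
  suffices Ψ ∘ₗ Representation.ind φ ρ h = π h ∘ₗ Ψ from LinearMap.congr_fun this
  refine IndV.hom_ext φ ρ fun h' => LinearMap.ext fun a => ?_
  change Ψ (Representation.ind φ ρ h (IndV.mk φ ρ h' a)) = π h (Ψ (IndV.mk φ ρ h' a))
  rw [ind_mk, hΨ, hΨ, mul_inv_rev, inv_inv, hmul]

end Induction

/-! ### The degree bounds and the minimal polynomials. -/

namespace YoungDiagram

variable {μ : YoungDiagram} {n : ℕ} {F : Type*} [Field F]

theorem exists_tableau_symm_last (hμ : μ.card = n + 1) {c : ℕ × ℕ} (hc : c ∈ μ.cells) :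
    ∃ t : Tableau μ (n + 1), (t.symm (Fin.last n)).1 = c := by
  let t₀ : Tableau μ (n + 1) := μ.cells.equivFinOfCardEq hμ
  refine ⟨t₀.trans (swap (t₀ ⟨c, hc⟩) (Fin.last n)), ?_⟩
  simp

theorem Tableau.one_mem_colStabilizer (t : Tableau μ n) : 1 ∈ t.colStabilizer :=
  t.mem_colStabilizer.2 fun _ => rfl

theorem aeval_restrictedSpecht_ne_zero (hμ : μ.card = n + 1) {q : F[X]} (hq : q ≠ 0)
    (hdeg : q.natDegree < μ.removableNodes.card) :
    aeval ((restrictedSpecht F μ n).asAlgebraHom (transpositionSum F n)) q ≠ 0 := by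
  have h00 : (0, 0) ∈ μ := by
    obtain ⟨⟨i, j⟩, hij⟩ := Finset.card_pos.1 ((Nat.succ_pos n).trans_eq hμ.symm)
    exact μ.up_left_mem (Nat.zero_le i) (Nat.zero_le j) ((mem_cells _).1 hij)
  -- This is the removable node in the bottom row. With the last letter there, the other removable
  -- nodes lie strictly higher and form a chain of one letter fewer than there are removable nodes.
  have hc := removable_of_mem h00
  obtain ⟨t, ht⟩ := exists_tableau_symm_last hμ (mem_removableNodes.1 hc).1
  have htr : (t.symm (Fin.last n)).1 ∈ μ.removableNodes := by rwa [ht]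
  have htrow : t.row (Fin.last n) = μ.colLen 0 - 1 := congrArg Prod.fst ht
  obtain ⟨xs, hxs, hxsA, hlen⟩ := t.exists_list_removable
    (({x | (t.symm x).1 ∈ μ.removableNodes} : Finset (Fin (n + 1))).erase (Fin.last n))
    fun x hx => (Finset.mem_filter.1 (Finset.mem_erase.1 hx).2).2
  rw [Finset.card_erase_of_mem (by simpa using htr), t.card_filter_removable] at hlen
  have hchain : IsColumnEndChain t.row t.col xs := by
    refine ⟨hxs, fun x hx => ?_⟩
    rw [← List.mem_toFinset, hxsA, Finset.mem_erase, Finset.mem_filter] at hx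
    obtain ⟨hxl, -, hxr⟩ := hx
    have hr : t.row x ≠ t.row (Fin.last n) := fun h => hxl (t.eq_of_removable hxr htr (Or.inl h))
    have h1 := (t.row_lt x).trans_le (μ.colLen_anti 0 (t.col x) (Nat.zero_le _))
    exact ⟨by omega, fun h => hxl (t.eq_of_removable hxr htr (Or.inr h)),
      fun w hw => t.row_le_of_removable hxr hw⟩
  have he := isPolytabloidFamily_specht (μ := μ) (n := n + 1) F
  have hemb : ∀ (σ : Perm (Fin (n + 1))) (T : Tabloid μ (n + 1)),
      (σ • T).1 ∘ (MonoidHom.id (Perm (Fin (n + 1)))) σ = T.1 := fun σ T => funext fun x =>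
    congrArg T.1 (σ.symm_apply_apply x)
  refine aeval_ne_zero_of_signedSum (τ := μ.specht F (n + 1))
    (Ψ := tabloidPlacement F (fun T : Tabloid μ (n + 1) => T.1) ∘ₗ Submodule.subtype _)
    (fun g v => tabloidPlacement_permRep F hemb g v.1)
    (fun π hπ => t.mem_colStabilizer.1 hπ) Function.injective_id t.one_mem_colStabilizer (by simp)
    (fun x y => t.eq_of_row_of_col) hchain (v := t.spechtVec F)
    (tabloidPlacement_polytabloid F hemb t) (a := μ.residueSum F) (b := -1) ?_
    (neg_ne_zero.2 one_ne_zero) ?_ hq (by omega)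
  · exact he.commute_restrict
  · exact he.restrict_apply _

theorem aeval_inducedSpecht_ne_zero (hμ : μ.card = n + 1) {q : F[X]} (hq : q ≠ 0)
    (hdeg : q.natDegree ≤ μ.removableNodes.card) :
    aeval ((inducedSpecht F μ (n + 1)).asAlgebraHom (transpositionSum F (n + 2))) q ≠ 0 := by
  let t : Tableau μ (n + 1) := μ.cells.equivFinOfCardEq hμ
  obtain ⟨xs, hxs, hxsA, hlen⟩ := t.exists_list_removable
    ({x | (t.symm x).1 ∈ μ.removableNodes} : Finset (Fin (n + 1)))
    fun x hx => (Finset.mem_filter.1 hx).2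
  rw [t.card_filter_removable] at hlen
  -- The new last letter is given row `colLen 0` and column `rowLen 0`, both outside the diagram. It
  -- then lies below all removable nodes and shares no column with them, so every removable node
  -- joins the chain.
  let ext (f : Fin (n + 1) → ℕ) (b : ℕ) : Fin (n + 2) → ℕ := Fin.snoc (α := fun _ => ℕ) f b
  have ext_castSucc : ∀ f b x, ext f b x.castSucc = f x := fun f b x =>
    Fin.snoc_castSucc (α := fun _ => ℕ) b f x
  have ext_last : ∀ f b, ext f b (Fin.last (n + 1)) = b := fun f b =>
    Fin.snoc_last (α := fun _ => ℕ) b f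
  have hrowlt : ∀ x, t.row x < μ.colLen 0 := fun x =>
    (t.row_lt x).trans_le (μ.colLen_anti 0 _ (Nat.zero_le _))
  have hcollt : ∀ x, t.col x < μ.rowLen 0 := fun x =>
    (t.col_lt x).trans_le (μ.rowLen_anti 0 _ (Nat.zero_le _))
  have hchain : IsColumnEndChain (ext t.row (μ.colLen 0)) (ext t.col (μ.rowLen 0))
      (xs.map Fin.castSucc) := by
    refine ⟨List.pairwise_map.2 (by simpa only [ext_castSucc] using hxs), fun x hx => ?_⟩
    obtain ⟨x, hx', rfl⟩ := List.mem_map.1 hx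
    rw [← List.mem_toFinset, hxsA, Finset.mem_filter] at hx'
    simp only [ext_castSucc, ext_last]
    refine ⟨hrowlt x, (hcollt x).ne, fun w => ?_⟩
    refine Fin.lastCases (fun hw => ?_) (fun w hw => ?_) w
    · rw [ext_last] at hw
      exact absurd hw (hcollt x).ne'
    · rw [ext_castSucc] at hw ⊢
      exact t.row_le_of_removable hx'.2 hw
  have he := isPolytabloidFamily_specht (μ := μ) (n := n + 1) F
  have hemb : ∀ (σ : Perm (Fin (n + 1))) (T : Tabloid μ (n + 1)),
      ext (σ • T).1 (μ.colLen 0) ∘ permEmb (n + 1) σ = ext T.1 (μ.colLen 0) := by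
    refine fun σ T => funext fun x => ?_
    rw [Function.comp_apply]
    refine Fin.lastCases ?_ (fun x => ?_) x
    · rw [permEmb_apply_last, ext_last, ext_last]
    · rw [permEmb_apply_castSucc, ext_castSucc, ext_castSucc]
      exact congrArg T.1 (σ.symm_apply_apply x)
  obtain ⟨Ψ, hΨ1, hΨ⟩ := exists_ind_lift (φ := permEmb (n + 1)) (ρ := μ.specht F (n + 1))
    (placementRep F (n + 2))
    (tabloidPlacement F (fun T : Tabloid μ (n + 1) => ext T.1 (μ.colLen 0)) ∘ₗ
      Submodule.subtype _) fun g v => tabloidPlacement_permRep F hemb g v.1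
  refine aeval_ne_zero_of_signedSum (τ := inducedSpecht F μ (n + 1)) hΨ
    (row := ext t.row (μ.colLen 0)) (col := ext t.col (μ.rowLen 0)) (emb := permEmb (n + 1))
    (fun π hπ => ?_) (Perm.viaEmbeddingHom_injective _) t.one_mem_colStabilizer (by simp)
    ?_ hchain (v := Representation.IndV.mk _ _ 1 (t.spechtVec F))
    ((hΨ1 _).trans (tabloidPlacement_polytabloid F hemb t)) (a := μ.residueSum F) (b := 1) ?_
    one_ne_zero ?_ hq (by rw [List.length_map]; omega)
  · refine Fin.lastCases ?_ fun x => ?_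
    · rw [permEmb_apply_last]
    · rw [permEmb_apply_castSucc, ext_castSucc, ext_castSucc, t.mem_colStabilizer.1 hπ]
  · refine Fin.lastCases ?_ fun x => ?_
    · refine Fin.lastCases (fun _ _ => rfl) fun y hy => ?_
      rw [ext_last, ext_castSucc] at hy
      exact absurd hy (hrowlt y).ne'
    · refine Fin.lastCases (fun hx => ?_) fun y hr hc => ?_
      · rw [ext_last, ext_castSucc] at hx
        exact absurd hx (hrowlt x).ne
      · rw [ext_castSucc, ext_castSucc] at hr hc
        rw [t.eq_of_row_of_col hr hc]
  · refine LinearMap.ext fun w => ?_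
    rw [Module.End.mul_apply, Module.End.mul_apply, lastTranspositions, LinearMap.sum_apply,
      LinearMap.sum_apply, map_sum]
    exact Finset.sum_congr rfl fun i _ => transpositionSum_apply_comm _ _ _
  · rw [one_smul]
    exact (he.transpositionSum_apply (ι := Representation.IndV.mk _ _ 1) ind_apply_mk_one _).trans
      (add_comm _ _)

end YoungDiagram

theorem theorem2p7 {F : Type*} [Field F] (n : ℕ) (μ : YoungDiagram) (hμ : μ.card = n + 1)
    (m : ℕ) (hm : m = μ.rowLens.toFinset.card) :
    (μ.removableNodes.card = m ∧
      minpoly F ((restrictedSpecht F μ n).asAlgebraHom (transpositionSum F n)) =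
        ∏ c ∈ μ.removableNodes.attach, (X - C ((μ.removeNode c.1 c.2).residueSum F))) ∧
    (μ.addableNodes.card = m + 1 ∧
      minpoly F ((inducedSpecht F μ (n + 1)).asAlgebraHom (transpositionSum F (n + 2))) =
        ∏ c ∈ μ.addableNodes.attach, (X - C ((μ.addNode c.1 c.2).residueSum F))) := by
  have he := YoungDiagram.isPolytabloidFamily_specht (μ := μ) (n := n + 1) F
  subst hm
  refine ⟨⟨μ.card_removableNodes, ?_⟩, ⟨μ.card_addableNodes, ?_⟩⟩
  · simp only [YoungDiagram.residueSum_removeNode]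
    rw [Finset.prod_attach _ fun c : ℕ × ℕ => X - C (μ.residueSum F - ((c.2 : F) - c.1))]
    exact minpoly_eq_prod _ _ he.aeval_restrict
      fun q hq hdeg => YoungDiagram.aeval_restrictedSpecht_ne_zero hμ hq hdeg
  · simp only [YoungDiagram.residueSum_addNode]
    rw [Finset.prod_attach _ fun c : ℕ × ℕ => X - C (μ.residueSum F + ((c.2 : F) - c.1))]
    refine minpoly_eq_prod _ _ (he.aeval_induced (ι := Representation.IndV.mk _ _ 1)
      ind_apply_mk_one span_ind_mk_one)
      fun q hq hdeg => YoungDiagram.aeval_inducedSpecht_ne_zero hμ hq ?_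
    rw [μ.card_addableNodes, ← μ.card_removableNodes] at hdeg
    omega
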